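/- **Proposition 8.4.** An *inverse sequence* $\underline X=(X_n,p_n)_{n\in\mathbb N}$ is an inverse system of sets indexed by $\mathbb N$, with bonding maps $p_{nm}\colon X_m\to X_n$ for $n\le m$. A *morphism of sequences* $(f_n,\Phi)\colon(X_n,p_n)\to(Y_n,q_n)$ is a function $\Phi\colon\mathbb N\to\mathbb N$ with maps $f_n\colon X_{\Phi(n)}\to Y_n$ such that for all $n\le n'$ there is $m\ge\Phi(n),\Phi(n')$ with $f_n\circ p_{\Phi(n)m}=q_{nn'}\circ f_{n'}\circ p_{\Phi(n')m}$. Two of them are equivalent, $(f_n,\Phi)\sim(g_n,\Psi)$, if for every $n$ there is $m\ge\Phi(n),\Psi(n)$ with $f_n\circ p_{\Phi(n)m}=g_n\circ p_{\Psi(n)m}$. **Tower-Set** is the category of inverse sequences and equivalence classes of morphisms of sequences. A *rooted simplicial tree* $(T,v)$ is the geometric realization of a (combinatorial) tree with a chosen root vertex $v$, with the length metric in which every edge has length $1$. A continuous map $f\colon(T,v)\to(T',w)$ is *rooted* if $f(v)=w$, and *metrically proper* if preimages of bounded sets are bounded. A *rooted metrically proper homotopy* between rooted metrically proper continuous maps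 $f,f'$ is a continuous $H\colon T\times I\to T'$ from $f$ to $f'$ with $H(v,t)=w$ for all $t$ and such that for every $M>0$ there is $N>0$ with $H^{-1}(B(w,M))\subset B(v,N)\times I$. Let $\mathcal T^*$ be the category of rooted simplicial trees and rooted metrically proper homotopy classes of rooted metrically proper continuous maps; its isomorphisms are the classes of rooted metrically proper homotopy equivalences. For a category $\mathcal C$ fix a representative in every isomorphism class of objects; the *category of isomorphism classes* of $\mathcal C$ has these classes as objects, and the morphisms $a\to b$ are the morphisms of $\mathcal C$ from the representative of $a$ to that of $b$. Let **Tower-Set**$^*$ be the category of isomorphism classes of **Tower-Set**. In the category of isomorphism classes of $\mathcal T^*$, say that a morphism $\varphi\colon a\to b$ is *the class of a simplicial map preserving the distance to the root* if there are trees $(S,v)\in a$, $(T,w)\in b$, a simplicial map $f\colon S\to T$ with $d(w,f(p))=d(v,p)$ for all $p\in S$, and isomorphisms $i,j$ in $\mathcal T^*$ from the representatives of $a,b$ to $S,T$ such that $j\circ\varphi=[f]\circ i$. Then these classes of simplicial maps contain the identities and are closed under composition, so that they are the morphisms of a category whose objects are the isomorphism classes of rooted simplicial trees, and **Tower-Set**$^*$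 is equivalent to this category. -/

import Mathlib

open CategoryTheory

universe u

/-! ## Inverse sequences of sets and the category of towers -/

/-- An inverse sequence of (small) sets: an inverse system of sets indexed by `ℕ`;
`X.bond h : X m → X n` is the bonding map `p_{nm}` for `n ≤ m`. -/
structure TowerSet : Type (u + 1) where
  obj : ℕ → Type u
  bond : ∀ {n m : ℕ}, n ≤ m → obj m → obj n
  bond_refl : ∀ (n : ℕ) (x : obj n), bond (le_refl n) x = x
  bond_bond : ∀ {n m k : ℕ} (h : n ≤ m) (h' : m ≤ k) (x : obj k),
    bond h (bond h' x) = bond (h.trans h') x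

namespace TowerSet

/-- A morphism of inverse sequences `(f_n, Φ)`: an index function `Φ : ℕ → ℕ` and maps
`f_n : X_{Φ n} → Y_n` such that for `n ≤ n'` the maps `f_n ∘ p` and `q_{nn'} ∘ f_{n'} ∘ p` agree on
`X_m` for some `m`. -/
structure SeqHom (X Y : TowerSet.{u}) : Type u where
  idx : ℕ → ℕ
  map : ∀ n, X.obj (idx n) → Y.obj n
  coherent : ∀ {n n' : ℕ} (h : n ≤ n'), ∃ (m : ℕ) (h₁ : idx n ≤ m) (h₂ : idx n' ≤ m),
    ∀ x : X.obj m, map n (X.bond h₁ x) = Y.bond h (map n' (X.bond h₂ x))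

/-- The equivalence of morphisms of sequences: `(f_n, Φ) ∼ (g_n, Ψ)` if for every `n` there is
`m ≥ Φ n, Ψ n` such that `f_n ∘ p_{Φ(n) m} = g_n ∘ p_{Ψ(n) m}`. -/
def SeqHom.Equiv {X Y : TowerSet.{u}} (f g : SeqHom X Y) : Prop :=
  ∀ n, ∃ (m : ℕ) (h₁ : f.idx n ≤ m) (h₂ : g.idx n ≤ m),
    ∀ x : X.obj m, f.map n (X.bond h₁ x) = g.map n (X.bond h₂ x)

instance SeqHom.setoid (X Y : TowerSet.{u}) : Setoid (SeqHom X Y) where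
  r := SeqHom.Equiv
  iseqv :=
    { refl := fun f n => ⟨f.idx n, le_rfl, le_rfl, fun _ => rfl⟩
      symm := fun {f g} h n => by
        obtain ⟨m, h₁, h₂, e⟩ := h n
        exact ⟨m, h₂, h₁, fun x => (e x).symm⟩
      trans := fun {f g k} h h' n => by
        obtain ⟨m, h₁, h₂, e⟩ := h n
        obtain ⟨m', h₁', h₂', e'⟩ := h' n
        refine ⟨max m m', h₁.trans (le_max_left _ _), h₂'.trans (le_max_right _ _), fun x => ?_⟩
        have a := e (X.bond (le_max_left m m') x)
        have b := e' (X.bond (le_max_right m m') x)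
        simp only [bond_bond] at a b
        exact a.trans b }

/-- The identity morphism of sequences. -/
def SeqHom.id (X : TowerSet.{u}) : SeqHom X X where
  idx n := n
  map _ x := x
  coherent {n n'} h := ⟨n', h, le_rfl, fun x => by rw [bond_refl]⟩

/-- The composite `(g_n, Ψ) ∘ (f_n, Φ) = (g_n ∘ f_{Ψ n}, Φ ∘ Ψ)`. -/
def SeqHom.comp {X Y Z : TowerSet.{u}} (f : SeqHom X Y) (g : SeqHom Y Z) : SeqHom X Z where
  idx n := f.idx (g.idx n)
  map n x := g.map n (f.map (g.idx n) x)
  coherent {n n'} h := by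
    obtain ⟨m, h₁, h₂, e⟩ := g.coherent h
    obtain ⟨a, a₁, a₂, ea⟩ := f.coherent h₁
    obtain ⟨b, b₁, b₂, eb⟩ := f.coherent h₂
    refine ⟨max a b, a₁.trans (le_max_left _ _), b₁.trans (le_max_right _ _), fun x => ?_⟩
    have ha := ea (X.bond (le_max_left a b) x)
    have hb := eb (X.bond (le_max_right a b) x)
    simp only [bond_bond] at ha hb
    rw [ha, hb]
    exact e _

theorem SeqHom.comp_equiv {X Y Z : TowerSet.{u}} {f f' : SeqHom X Y} {g g' : SeqHom Y Z}
    (hf : f ≈ f') (hg : g ≈ g') : f.comp g ≈ f'.comp g' := by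
  intro n
  obtain ⟨m, h₁, h₂, e⟩ := hg n
  obtain ⟨a, a₁, a₂, ea⟩ := f.coherent h₁
  obtain ⟨b, b₁, b₂, eb⟩ := f'.coherent h₂
  obtain ⟨c, c₁, c₂, ec⟩ := hf m
  have la : a ≤ max a (max b c) := le_max_left _ _
  have lb : b ≤ max a (max b c) := (le_max_left _ _).trans (le_max_right _ _)
  have lc : c ≤ max a (max b c) := (le_max_right _ _).trans (le_max_right _ _)
  refine ⟨max a (max b c), a₁.trans la, b₁.trans lb, fun x => ?_⟩
  have ha := ea (X.bond la x)
  have hb := eb (X.bond lb x)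
  have hc := ec (X.bond lc x)
  simp only [bond_bond] at ha hb hc
  exact (congrArg (g.map n) ha).trans ((e _).trans (congrArg (g'.map n)
    ((congrArg (Y.bond h₂) hc).trans hb.symm)))

/-- The category **Tower-Set**: inverse sequences of sets and equivalence classes of morphisms of
sequences. -/
instance : Category.{u} TowerSet.{u} where
  Hom X Y := Quotient (SeqHom.setoid X Y)
  id X := Quotient.mk _ (SeqHom.id X)
  comp f g := Quotient.map₂ SeqHom.comp (fun _ _ hf _ _ hg => SeqHom.comp_equiv hf hg) f g
  id_comp := by rintro X Y ⟨f⟩; rfl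
  comp_id := by rintro X Y ⟨f⟩; rfl
  assoc := by rintro X Y Z W ⟨f⟩ ⟨g⟩ ⟨h⟩; rfl

end TowerSet

/-- The category **Tower-Set***: its objects are the isomorphism classes of inverse sequences, and
a morphism from one class to another is a morphism of **Tower-Set** between the chosen
representatives of the classes. -/
abbrev TowerSetStar : Type (u + 1) := Skeleton TowerSet.{u}

/-! ## Rooted simplicial trees and their geometric realizations -/

/-- A rooted simplicial tree: a combinatorial tree together with a root vertex. -/
structure RootedSimplicialTree : Type (u + 1) where
  V : Type u
  graph : SimpleGraph V
  isTree : graph.IsTree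
  root : V

namespace RootedSimplicialTree

variable (T : RootedSimplicialTree.{u})

/-- The vertices `x, y` span a simplex (a vertex if `x = y`, an edge otherwise). -/
def Spans (x y : T.V) : Prop := x = y ∨ T.graph.Adj x y

/-- A point of the geometric realization, given by its barycentric coordinates: nonnegative
weights on the vertices, with sum `1`, supported on a vertex or on the two ends of an edge. -/
@[ext]
structure Realization : Type u where
  coord : T.V →₀ ℝ
  nonneg : ∀ x, 0 ≤ coord x
  sum_eq_one : (coord.sum fun _ t => t) = 1
  carried : ∃ x y, T.Spans x y ∧ (coord.support : Set T.V) ⊆ {x, y}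

variable {T}

namespace Realization

/-- The point `p` lies on the closed simplex spanned by `x` and `y`. -/
def OnSimplex (p : T.Realization) (x y : T.V) : Prop :=
  (p.coord.support : Set T.V) ⊆ {x, y}

/-- A vertex, as a point of the realization. -/
noncomputable def vertex (x : T.V) : T.Realization where
  coord := Finsupp.single x 1
  nonneg y := by
    classical
    rw [Finsupp.single_apply]; split_ifs <;> norm_num
  sum_eq_one := by simp
  carried := ⟨x, x, Or.inl rfl, by
    intro y hy
    have := Finsupp.support_single_subset hy
    simpa using this⟩

/-- `IsPathLength p q ℓ`: there is a finite chain of points from `p` to `q`, any two consecutive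
ones lying on a common closed edge, of total length `ℓ`, where every edge is isometric to `[0, 1]`,
so that points `p, p'` on the closed edge with ends `x, y` are at distance `|p x - p' x|`. -/
inductive IsPathLength : T.Realization → T.Realization → ℝ → Prop
  | refl (p : T.Realization) : IsPathLength p p 0
  | step {p p' q : T.Realization} {x y : T.V} {l : ℝ} (hxy : T.Spans x y)
      (hp : p.OnSimplex x y) (hp' : p'.OnSimplex x y) (h : IsPathLength p' q l) :
      IsPathLength p q (|p.coord x - p'.coord x| + l)

theorem coord_eq_zero {p : T.Realization} {x y z : T.V} (hp : p.OnSimplex x y) (hx : z ≠ x)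
    (hy : z ≠ y) : p.coord z = 0 := by
  by_contra h
  have := hp (Finset.mem_coe.2 (Finsupp.mem_support_iff.2 h))
  simp [hx, hy] at this

theorem coord_add {p : T.Realization} {x y : T.V} (hp : p.OnSimplex x y) (hxy : x ≠ y) :
    p.coord x + p.coord y = 1 := by
  classical
  have h := p.sum_eq_one
  rw [Finsupp.sum_of_support_subset p.coord (s := {x, y})
    (by intro z hz; simpa using hp (Finset.mem_coe.2 hz)) _ (by simp)] at h
  rwa [Finset.sum_pair hxy] at h

theorem coord_self {p : T.Realization} {x : T.V} (hp : p.OnSimplex x x) : p.coord x = 1 := by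
  classical
  have h := p.sum_eq_one
  rw [Finsupp.sum_of_support_subset p.coord (s := {x})
    (by intro z hz; simpa using hp (Finset.mem_coe.2 hz)) _ (by simp)] at h
  simpa using h

theorem abs_coord_sub_le_step {p q : T.Realization} {x y : T.V} (hp : p.OnSimplex x y)
    (hq : q.OnSimplex x y) (z : T.V) : |p.coord z - q.coord z| ≤ |p.coord x - q.coord x| := by
  by_cases hzx : z = x
  · rw [hzx]
  by_cases hzy : z = y
  · subst hzy
    have h₁ := coord_add hp (Ne.symm hzx)
    have h₂ := coord_add hq (Ne.symm hzx)
    have : p.coord z - q.coord z = -(p.coord x - q.coord x) := by linarith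
    rw [this, abs_neg]
  · rw [coord_eq_zero hp hzx hzy, coord_eq_zero hq hzx hzy]
    simp

theorem IsPathLength.abs_coord_sub_le {p q : T.Realization} {l : ℝ} (h : IsPathLength p q l)
    (z : T.V) : |p.coord z - q.coord z| ≤ l := by
  induction h with
  | refl p => simp
  | @step p p' q x y l hxy hp hp' h ih =>
    have h₁ := abs_coord_sub_le_step hp hp' z
    have h₂ := abs_sub_le (p.coord z) (p'.coord z) (q.coord z)
    linarith

theorem IsPathLength.nonneg {p q : T.Realization} {l : ℝ} (h : IsPathLength p q l) : 0 ≤ l :=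
  (abs_nonneg _).trans (h.abs_coord_sub_le T.root)

theorem IsPathLength.trans {p q r : T.Realization} {l l' : ℝ} (h : IsPathLength p q l)
    (h' : IsPathLength q r l') : IsPathLength p r (l + l') := by
  induction h with
  | refl p => simpa using h'
  | step hxy hp hp' h ih =>
    rw [add_assoc]
    exact .step hxy hp hp' (ih h')

theorem IsPathLength.symm {p q : T.Realization} {l : ℝ} (h : IsPathLength p q l) :
    IsPathLength q p l := by
  induction h with
  | refl p => exact .refl p
  | @step p p' q x y l hxy hp hp' h ih =>
    have h₁ : IsPathLength p' p (|p'.coord x - p.coord x| + 0) := .step hxy hp' hp (.refl p)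
    have h₂ := ih.trans h₁
    rwa [add_zero, abs_sub_comm, add_comm] at h₂

theorem vertex_onSimplex_left (x y : T.V) : (vertex x).OnSimplex x y := by
  intro z hz
  have := Finsupp.support_single_subset hz
  exact Or.inl (by simpa using this)

theorem vertex_onSimplex_right (x y : T.V) : (vertex y).OnSimplex x y := by
  intro z hz
  have := Finsupp.support_single_subset hz
  exact Or.inr (by simpa using this)

theorem exists_isPathLength (p q : T.Realization) : ∃ l, IsPathLength p q l := by
  have hv : ∀ r : T.Realization, ∃ (x : T.V) (l : ℝ), IsPathLength r (vertex x) l := by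
    intro r
    obtain ⟨x, y, hxy, hr⟩ := r.carried
    exact ⟨x, _, .step hxy hr (vertex_onSimplex_left x y) (.refl _)⟩
  have hw : ∀ {x y : T.V}, T.graph.Walk x y → ∃ l, IsPathLength (vertex x) (vertex y) l := by
    intro x y w
    induction w with
    | nil => exact ⟨0, .refl _⟩
    | cons h w ih =>
      obtain ⟨l, hl⟩ := ih
      exact ⟨_, .step (Or.inr h) (vertex_onSimplex_left _ _) (vertex_onSimplex_right _ _) hl⟩
  obtain ⟨x, l, hl⟩ := hv p
  obtain ⟨y, l', hl'⟩ := hv q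
  obtain ⟨w⟩ := T.isTree.connected.preconnected x y
  obtain ⟨k, hk⟩ := hw w
  exact ⟨_, (hl.trans hk).trans hl'.symm⟩

/-- The length metric on the realization in which every edge has length `1`: the distance of two
points is the infimum of the lengths of the chains joining them. -/
noncomputable instance : MetricSpace T.Realization where
  dist p q := sInf {l | IsPathLength p q l}
  dist_self p := le_antisymm
    (csInf_le ⟨0, fun _ h => h.nonneg⟩ (IsPathLength.refl p))
    (le_csInf ⟨0, .refl p⟩ fun _ h => h.nonneg)
  dist_comm p q := by
    congr 1
    ext l
    exact ⟨fun h => h.symm, fun h => h.symm⟩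
  dist_triangle p q r := by
    refine le_of_forall_pos_lt_add fun ε hε => ?_
    obtain ⟨l, hl, hl'⟩ := exists_lt_of_csInf_lt (exists_isPathLength p q)
      (show sInf {l | IsPathLength p q l} < sInf {l | IsPathLength p q l} + ε / 2 by linarith)
    obtain ⟨k, hk, hk'⟩ := exists_lt_of_csInf_lt (exists_isPathLength q r)
      (show sInf {l | IsPathLength q r l} < sInf {l | IsPathLength q r l} + ε / 2 by linarith)
    have : sInf {l | IsPathLength p r l} ≤ l + k :=
      csInf_le ⟨0, fun _ h => h.nonneg⟩ (IsPathLength.trans hl hk)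
    linarith
  eq_of_dist_eq_zero {p q} h := by
    refine Realization.ext (Finsupp.ext fun z => ?_)
    have h₁ : |p.coord z - q.coord z| ≤ sInf {l | IsPathLength p q l} :=
      le_csInf (exists_isPathLength p q) fun l hl => hl.abs_coord_sub_le z
    have h₂ : |p.coord z - q.coord z| ≤ 0 := h₁.trans h.le
    exact sub_eq_zero.1 (abs_nonpos_iff.1 h₂)

end Realization

variable (T) in
/-- The root, as a point of the realization. -/
noncomputable def rootPt : T.Realization := Realization.vertex T.root

/-! ## Rooted metrically proper maps and homotopies -/

/-- A rooted continuous metrically proper map between the realizations of two rooted trees: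
preimages of bounded sets are bounded. -/
structure MPMap (S T : RootedSimplicialTree.{u}) : Type u where
  toMap : C(S.Realization, T.Realization)
  map_root : toMap S.rootPt = T.rootPt
  proper : ∀ A : Set T.Realization, Bornology.IsBounded A → Bornology.IsBounded (toMap ⁻¹' A)

/-- A homotopy `H` is a rooted metrically proper homotopy if it fixes the root and for every
`M > 0` there is `N > 0` such that `H⁻¹(B(w, M)) ⊆ I × B(v, N)`. -/
def IsMPHomotopy {S T : RootedSimplicialTree.{u}} {f g : C(S.Realization, T.Realization)}
    (H : ContinuousMap.Homotopy f g) : Prop :=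
  (∀ t, H (t, S.rootPt) = T.rootPt) ∧
  ∀ M : ℝ, 0 < M → ∃ N : ℝ, 0 < N ∧
    ∀ t p, H (t, p) ∈ Metric.ball T.rootPt M → p ∈ Metric.ball S.rootPt N

/-- Two rooted metrically proper maps are rooted metrically proper homotopic. -/
def MPMap.Homotopic {S T : RootedSimplicialTree.{u}} (f g : MPMap S T) : Prop :=
  ∃ H : ContinuousMap.Homotopy f.toMap g.toMap, IsMPHomotopy H

namespace MPMap

/-- The identity map. -/
noncomputable def id (S : RootedSimplicialTree.{u}) : MPMap S S where
  toMap := ContinuousMap.id _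
  map_root := rfl
  proper _ h := h

/-- The composite `g ∘ f`. -/
noncomputable def comp {R S T : RootedSimplicialTree.{u}} (f : MPMap R S) (g : MPMap S T) : MPMap R T where
  toMap := g.toMap.comp f.toMap
  map_root := by simp [f.map_root, g.map_root]
  proper A h := f.proper _ (g.proper A h)

theorem exists_ball {S T : RootedSimplicialTree.{u}} (f : MPMap S T) (M : ℝ) :
    ∃ N : ℝ, 0 < N ∧ ∀ p, f.toMap p ∈ Metric.ball T.rootPt M → p ∈ Metric.ball S.rootPt N := by
  obtain ⟨N, hN, h⟩ := (f.proper _ (Metric.isBounded_ball (x := T.rootPt) (r := M))).subset_ball_lt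
    0 S.rootPt
  exact ⟨N, hN, fun p hp => h hp⟩

instance setoid (S T : RootedSimplicialTree.{u}) : Setoid (MPMap S T) where
  r := MPMap.Homotopic
  iseqv :=
    { refl := fun f => ⟨ContinuousMap.Homotopy.refl _, fun _ => f.map_root, fun M _ => by
        obtain ⟨N, hN, h⟩ := f.exists_ball M
        exact ⟨N, hN, fun _ p hp => h p hp⟩⟩
      symm := fun {f g} ⟨H, h₁, h₂⟩ => ⟨H.symm, fun t => h₁ _, fun M hM => by
        obtain ⟨N, hN, h⟩ := h₂ M hM
        exact ⟨N, hN, fun t p hp => h _ p hp⟩⟩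
      trans := fun {f g k} ⟨H, h₁, h₂⟩ ⟨K, k₁, k₂⟩ => ⟨H.trans K, fun t => by
          rw [ContinuousMap.Homotopy.trans_apply]
          split_ifs
          · exact h₁ _
          · exact k₁ _, fun M hM => by
          obtain ⟨N, hN, h⟩ := h₂ M hM
          obtain ⟨N', hN', h'⟩ := k₂ M hM
          refine ⟨max N N', lt_max_of_lt_left hN, fun t p hp => ?_⟩
          rw [ContinuousMap.Homotopy.trans_apply] at hp
          split_ifs at hp
          · exact Metric.ball_subset_ball (le_max_left _ _) (h _ p hp)
          · exact Metric.ball_subset_ball (le_max_right _ _) (h' _ p hp)⟩ }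

theorem comp_homotopic {R S T : RootedSimplicialTree.{u}} {f f' : MPMap R S} {g g' : MPMap S T}
    (hf : f ≈ f') (hg : g ≈ g') : f.comp g ≈ f'.comp g' := by
  obtain ⟨H, h₁, h₂⟩ := hf
  obtain ⟨K, k₁, k₂⟩ := hg
  refine ⟨K.comp H, fun t => ?_, fun M hM => ?_⟩
  · change K (t, H (t, R.rootPt)) = T.rootPt
    rw [h₁, k₁]
  · obtain ⟨N, hN, k⟩ := k₂ M hM
    obtain ⟨N', hN', h⟩ := h₂ N hN
    exact ⟨N', hN', fun t p hp => h t p (k t _ hp)⟩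

/-- The map is simplicial: it is induced by a map of vertices sending simplices to simplices,
extended linearly in barycentric coordinates. -/
def IsSimplicial {S T : RootedSimplicialTree.{u}} (f : MPMap S T) : Prop :=
  ∃ φ : S.V → T.V, (∀ x y, S.Spans x y → T.Spans (φ x) (φ y)) ∧
    ∀ p, (f.toMap p).coord = p.coord.mapDomain φ

/-- The map preserves the distance to the root. -/
def PreservesRootDist {S T : RootedSimplicialTree.{u}} (f : MPMap S T) : Prop :=
  ∀ p, dist T.rootPt (f.toMap p) = dist S.rootPt p

end MPMap

/-- The category of rooted simplicial trees and rooted metrically proper homotopy classes of rooted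
continuous metrically proper maps between their realizations. -/
noncomputable instance : Category.{u} RootedSimplicialTree.{u} where
  Hom S T := Quotient (MPMap.setoid S T)
  id S := Quotient.mk _ (MPMap.id S)
  comp f g := Quotient.map₂ MPMap.comp (fun _ _ hf _ _ hg => MPMap.comp_homotopic hf hg) f g
  id_comp := by rintro X Y ⟨f⟩; rfl
  comp_id := by rintro X Y ⟨f⟩; rfl
  assoc := by rintro X Y Z W ⟨f⟩ ⟨g⟩ ⟨h⟩; rfl

/-- The rooted metrically proper homotopy class of a map. -/
def MPMap.homotopyClass {S T : RootedSimplicialTree.{u}} (f : MPMap S T) : S ⟶ T := Quotient.mk _ f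

end RootedSimplicialTree

/-- Isomorphism classes of rooted simplicial trees: trees are identified if they are rooted
metrically proper homotopy equivalent, and a morphism from one class to another is a rooted
metrically proper homotopy class of maps between the chosen representatives of the classes. -/
abbrev TreeStar : Type (u + 1) := Skeleton RootedSimplicialTree.{u}

/-- The morphisms between isomorphism classes of rooted simplicial trees that are given by
simplicial maps preserving the distance to the root: there are trees `S` and `T` in the two classes,
a simplicial map `f : S → T` preserving the distance to the root, and isomorphisms `i`, `j` (rooted
metrically proper homotopy equivalences) making the square with sides `φ`, `f`, `i`, `j` commute. -/
def simplicialClasses : MorphismProperty TreeStar.{u} := fun a b φ =>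
  ∃ (S T : RootedSimplicialTree.{u}) (i : (fromSkeleton RootedSimplicialTree.{u}).obj a ≅ S)
    (j : (fromSkeleton RootedSimplicialTree.{u}).obj b ≅ T) (f : RootedSimplicialTree.MPMap S T),
    f.IsSimplicial ∧ f.PreservesRootDist ∧
      (fromSkeleton RootedSimplicialTree.{u}).map φ ≫ j.hom = i.hom ≫ f.homotopyClass

/-! A rooted tree T has an inverse sequence of levels: the vertices of depth n, bonded by passing to
ancestors. The proof shows that this extends to an equivalence `levelsFunctor` between rooted trees
up to metrically proper homotopy and towers of sets.

The points above height N fall into pieces, one above each vertex of depth N. A proper map f sends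
the points of height at least N to height at least n for suitable N, and by connectedness each piece
lands above a single vertex of depth n (`MPMap.level_eq_level_vertex`). This gives a morphism of
sequences (`MPMap.exists_induces`), unique up to equivalence, and unchanged by proper homotopies
because the track of a deep vertex is connected and stays high (`MPMap.Induces.of_homotopic`).

Faithfulness rests on the retractions onto balls around the root: f is properly homotopic to its
retraction to a radius ρ(p) tending to infinity, and if ρ grows slowly enough, two maps with the
same effect on deep vertices have the same retraction (`MPMap.homotopic_of_level_eq`). For fullness,
a vertex x is sent to the deepest level at which the morphism of sequences can already be evaluated
coherently at x (`exists_mpMap_induces`). For essential surjectivity, a root is added below a tower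
X to form a tree, whose levels are X shifted by one.

Simplicial maps preserving the distance to the root correspond to level morphisms. Every morphism of
towers becomes one after the source is replaced by a sparse cofinal subsequence, so every morphism
of trees belongs to the distinguished class (`simplicialClasses_eq_top`). Closure under composition
is then automatic, and the resulting category is the whole skeleton of the category of trees. -/

namespace RootedSimplicialTree

/-! ## Depth, parents and ancestors of vertices -/

section Combinatorics

variable {T : RootedSimplicialTree.{u}}

/-- The combinatorial distance of a vertex to the root. -/
noncomputable def depth (x : T.V) : ℕ := T.graph.dist T.root x

@[simp]
theorem depth_root : depth T.root = 0 := by simp [depth]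

theorem depth_eq_zero {x : T.V} : depth x = 0 ↔ x = T.root := by
  rw [depth, T.isTree.connected.dist_eq_zero_iff]
  exact eq_comm

theorem depth_of_adj {x y : T.V} (h : T.graph.Adj x y) :
    depth x = depth y + 1 ∨ depth y = depth x + 1 := by
  simpa [depth] using T.isTree.dist_eq_dist_add_one_of_adj T.root h

theorem exists_adj_depth {x : T.V} (hx : x ≠ T.root) :
    ∃ y, T.graph.Adj y x ∧ depth x = depth y + 1 := by
  obtain ⟨w, hw⟩ := T.isTree.connected.exists_walk_length_eq_dist T.root x
  have hn : ¬ w.Nil := fun h => hx h.eq.symm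
  refine ⟨w.penultimate, w.adj_penultimate hn, ?_⟩
  rcases depth_of_adj (w.adj_penultimate hn) with h | h
  · exfalso
    have h₁ : depth w.penultimate ≤ w.dropLast.length := SimpleGraph.dist_le _
    have h₂ : w.length = depth x := hw
    simp at h₁
    omega
  · exact h

/-- Geodesics from the root to y and to z, prolonged to x, are again geodesics, hence paths; a tree
has only one path from the root to x, so the penultimate vertices agree. -/
theorem adj_depth_unique {x y z : T.V} (hy : T.graph.Adj y x) (hz : T.graph.Adj z x)
    (hy' : depth x = depth y + 1) (hz' : depth x = depth z + 1) : y = z := by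
  obtain ⟨v, hv⟩ := T.isTree.connected.exists_walk_length_eq_dist T.root y
  obtain ⟨w, hw⟩ := T.isTree.connected.exists_walk_length_eq_dist T.root z
  have key : v.concat hy = w.concat hz := by
    have h₁ : (v.concat hy).IsPath := SimpleGraph.Walk.isPath_of_length_eq_dist _ (by
      rw [SimpleGraph.Walk.length_concat, hv]; exact hy'.symm)
    have h₂ : (w.concat hz).IsPath := SimpleGraph.Walk.isPath_of_length_eq_dist _ (by
      rw [SimpleGraph.Walk.length_concat, hw]; exact hz'.symm)
    exact congrArg Subtype.val ((T.isTree.isAcyclic.subsingleton_path _ _).elim ⟨_, h₁⟩ ⟨_, h₂⟩)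
  simpa using congrArg SimpleGraph.Walk.penultimate key

open Classical in
/-- The neighbour of a vertex on the way to the root; the root is its own parent. -/
noncomputable def parent (x : T.V) : T.V :=
  if h : x = T.root then T.root else (exists_adj_depth h).choose

@[simp]
theorem parent_root : parent T.root = T.root := by simp [parent]

theorem adj_parent {x : T.V} (hx : x ≠ T.root) : T.graph.Adj (parent x) x := by
  rw [parent, dif_neg hx]
  exact (exists_adj_depth hx).choose_spec.1

theorem depth_eq_depth_parent_add_one {x : T.V} (hx : x ≠ T.root) :
    depth x = depth (parent x) + 1 := by
  rw [parent, dif_neg hx]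
  exact (exists_adj_depth hx).choose_spec.2

theorem depth_parent (x : T.V) : depth (parent x) = depth x - 1 := by
  by_cases hx : x = T.root
  · simp [hx]
  · rw [depth_eq_depth_parent_add_one hx]
    rfl

theorem eq_parent_of_adj {x y : T.V} (h : T.graph.Adj y x) (h' : depth x = depth y + 1) :
    y = parent x := by
  have hx : x ≠ T.root := by
    rintro rfl
    simp at h'
  exact adj_depth_unique h (adj_parent hx) h' (depth_eq_depth_parent_add_one hx)

theorem spans_iff {x y : T.V} : T.Spans x y ↔ x = y ∨ x = parent y ∨ y = parent x := by
  constructor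
  · rintro (h | h)
    · exact Or.inl h
    · rcases depth_of_adj h with h' | h'
      · exact Or.inr (Or.inr (eq_parent_of_adj h.symm h'))
      · exact Or.inr (Or.inl (eq_parent_of_adj h h'))
  · rintro (h | h | h)
    · exact Or.inl h
    · by_cases hy : y = T.root
      · left
        rw [h, hy, parent_root]
      · right
        rw [h]
        exact adj_parent hy
    · by_cases hx : x = T.root
      · left
        rw [h, hx, parent_root]
      · right
        rw [h]
        exact (adj_parent hx).symm

theorem spans_parent (x : T.V) : T.Spans x (parent x) := spans_iff.2 (Or.inr (Or.inr rfl))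

/-- The ancestor of a vertex at a given depth; the vertex itself if the depth is too large. -/
noncomputable def anc (x : T.V) (k : ℕ) : T.V := parent^[depth x - k] x

theorem depth_iterate_parent (x : T.V) (j : ℕ) : depth (parent^[j] x) = depth x - j := by
  induction j with
  | zero => rfl
  | succ j ih => rw [Function.iterate_succ_apply', depth_parent, ih]; omega

theorem depth_anc (x : T.V) (k : ℕ) : depth (anc x k) = min k (depth x) := by
  rw [anc, depth_iterate_parent]; omega

theorem depth_anc_of_le {x : T.V} {k : ℕ} (h : k ≤ depth x) : depth (anc x k) = k := by
  rw [depth_anc, min_eq_left h]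

theorem anc_of_depth_le {x : T.V} {k : ℕ} (h : depth x ≤ k) : anc x k = x := by
  rw [anc, Nat.sub_eq_zero_of_le h]; rfl

@[simp]
theorem anc_depth (x : T.V) : anc x (depth x) = x := anc_of_depth_le le_rfl

@[simp]
theorem anc_zero (x : T.V) : anc x 0 = T.root := by
  rw [← depth_eq_zero, depth_anc]; simp

theorem anc_anc (x : T.V) {j k : ℕ} (h : j ≤ k) : anc (anc x k) j = anc x j := by
  rcases le_total (depth x) k with hk | hk
  · rw [anc_of_depth_le hk]
  · rw [anc, depth_anc_of_le hk, anc, ← Function.iterate_add_apply, anc]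
    congr 1
    omega

theorem anc_parent (x : T.V) {k : ℕ} (h : k ≤ depth (parent x)) : anc (parent x) k = anc x k := by
  by_cases hx : x = T.root
  · simp [hx]
  · have := depth_eq_depth_parent_add_one hx
    rw [anc, anc, ← Function.iterate_succ_apply]
    congr 1
    omega

theorem parent_eq_anc (x : T.V) : parent x = anc x (depth x - 1) := by
  rw [← depth_parent, ← anc_parent x le_rfl, anc_depth]

theorem parent_anc (x : T.V) {k : ℕ} (h : k + 1 ≤ depth x) : parent (anc x (k + 1)) = anc x k := by
  rw [parent_eq_anc, depth_anc_of_le h, Nat.add_sub_cancel, anc_anc x k.le_succ]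

end Combinatorics

end RootedSimplicialTree

namespace RootedSimplicialTree

namespace Realization

variable {T : RootedSimplicialTree.{u}}

/-! ## Points on edges and distance estimates -/

theorem OnSimplex.symm {p : T.Realization} {x y : T.V} (h : p.OnSimplex x y) :
    p.OnSimplex y x := by
  rw [OnSimplex, Set.pair_comm]
  exact h

theorem OnSimplex.eq_of_coord_eq {p q : T.Realization} {x y : T.V} (hp : p.OnSimplex x y)
    (hq : q.OnSimplex x y) (h : p.coord x = q.coord x) : p = q := by
  refine Realization.ext (Finsupp.ext fun z => ?_)
  have := abs_coord_sub_le_step hp hq z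
  rw [h, sub_self, abs_zero] at this
  exact sub_eq_zero.1 (abs_nonpos_iff.1 this)

theorem exists_onSimplex_parent (p : T.Realization) : ∃ x, p.OnSimplex x (parent x) := by
  obtain ⟨x, y, hxy, hp⟩ := p.carried
  rcases spans_iff.1 hxy with rfl | rfl | rfl
  · exact ⟨x, fun z hz => Or.inl (by simpa using hp hz)⟩
  · exact ⟨y, OnSimplex.symm hp⟩
  · exact ⟨x, hp⟩

theorem coord_le_one {p : T.Realization} {x y : T.V} (hp : p.OnSimplex x y) : p.coord x ≤ 1 := by
  by_cases hxy : x = y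
  · subst hxy
    exact (coord_self hp).le
  · have := coord_add hp hxy
    linarith [p.nonneg y]

theorem dist_le_of_onSimplex {p q : T.Realization} {x y : T.V} (hxy : T.Spans x y)
    (hp : p.OnSimplex x y) (hq : q.OnSimplex x y) : dist p q ≤ |p.coord x - q.coord x| :=
  csInf_le ⟨0, fun _ h => IsPathLength.nonneg h⟩
    (by simpa using IsPathLength.step hxy hp hq (.refl q))

theorem abs_coord_sub_le_dist (p q : T.Realization) (z : T.V) :
    |p.coord z - q.coord z| ≤ dist p q :=
  le_csInf (exists_isPathLength p q) fun _ hl => hl.abs_coord_sub_le z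

/-- A map that does not increase distances on edges does not increase distances. -/
theorem dist_map_le_of_edges {M : Type*} [PseudoMetricSpace M] {F : T.Realization → M}
    (h : ∀ (p q : T.Realization) (x y : T.V), T.Spans x y → p.OnSimplex x y → q.OnSimplex x y →
      dist (F p) (F q) ≤ |p.coord x - q.coord x|) (p q : T.Realization) :
    dist (F p) (F q) ≤ dist p q := by
  refine le_csInf (exists_isPathLength p q) fun l hl => ?_
  induction hl with
  | refl p => simp
  | step hxy hp hp' _ ih =>
    exact (dist_triangle _ _ _).trans (add_le_add (h _ _ _ _ hxy hp hp') ih)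

/-- The linear extension to the realization of a function on the vertices. -/
noncomputable def lin (F : T.V → ℝ) (p : T.Realization) : ℝ := p.coord.sum fun x t => t * F x

theorem lin_eq (F : T.V → ℝ) {p : T.Realization} {x y : T.V} (hp : p.OnSimplex x y) :
    lin F p = p.coord x * F x + (1 - p.coord x) * F y := by
  classical
  rw [lin, Finsupp.sum_of_support_subset p.coord (s := {x, y})
    (by intro z hz; simpa using hp (Finset.mem_coe.2 hz)) _ (by simp)]
  by_cases hxy : x = y
  · subst hxy
    simp [coord_self hp]
  · rw [Finset.sum_pair hxy, ← coord_add hp hxy]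
    ring

theorem dist_lin_le {F : T.V → ℝ} (h : ∀ x y, T.Spans x y → |F x - F y| ≤ 1)
    (p q : T.Realization) : dist (lin F p) (lin F q) ≤ dist p q := by
  refine dist_map_le_of_edges (fun p q x y hxy hp hq => ?_) p q
  rw [lin_eq F hp, lin_eq F hq, Real.dist_eq]
  have : p.coord x * F x + (1 - p.coord x) * F y - (q.coord x * F x + (1 - q.coord x) * F y)
      = (p.coord x - q.coord x) * (F x - F y) := by ring
  rw [this, abs_mul]
  exact mul_le_of_le_one_right (abs_nonneg _) (h x y hxy)

theorem continuous_lin {F : T.V → ℝ} (h : ∀ x y, T.Spans x y → |F x - F y| ≤ 1) :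
    Continuous (lin F) :=
  (LipschitzWith.of_dist_le_mul (K := 1) fun p q => by
    simpa using dist_lin_le h p q).continuous

/-- The height of a point: the linear extension of the depth. -/
noncomputable def height (p : T.Realization) : ℝ := lin (fun x => (depth x : ℝ)) p

theorem abs_depth_sub_le {x y : T.V} (h : T.Spans x y) : |(depth x : ℝ) - depth y| ≤ 1 := by
  rcases h with rfl | h
  · simp
  · rcases depth_of_adj h with h | h <;> simp [h]

theorem dist_height_le (p q : T.Realization) : dist (height p) (height q) ≤ dist p q :=
  dist_lin_le (fun _ _ => abs_depth_sub_le) p q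

theorem continuous_height : Continuous (height : T.Realization → ℝ) :=
  continuous_lin fun _ _ => abs_depth_sub_le

theorem height_nonneg (p : T.Realization) : 0 ≤ height p :=
  Finset.sum_nonneg fun x _ => mul_nonneg (p.nonneg x) (Nat.cast_nonneg _)

theorem height_le {p : T.Realization} {x : T.V} (hp : p.OnSimplex x (parent x)) :
    height p ≤ depth x := by
  rw [height, lin_eq _ hp]
  have h₁ : (depth (parent x) : ℝ) ≤ depth x := by
    rw [depth_parent]; exact_mod_cast Nat.sub_le _ _
  have h₂ := mul_le_mul_of_nonneg_left h₁ (sub_nonneg.2 (coord_le_one hp))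
  linarith

theorem height_eq {p : T.Realization} {x : T.V} (hp : p.OnSimplex x (parent x))
    (hx : x ≠ T.root) : height p = depth x - 1 + p.coord x := by
  rw [height, lin_eq _ hp, depth_eq_depth_parent_add_one hx]
  push_cast
  ring

theorem depth_sub_one_le_height {p : T.Realization} {x : T.V} (hp : p.OnSimplex x (parent x)) :
    depth x - 1 ≤ height p := by
  by_cases hx : x = T.root
  · subst hx
    have := height_nonneg p
    simp only [depth_root]
    push_cast
    linarith
  · rw [height_eq hp hx]
    linarith [p.nonneg x]

/-- The point on the edge from a vertex to its parent with given weight at the vertex. -/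
noncomputable def edgePt (x : T.V) (t : ℝ) : T.Realization where
  -- Clamping t to [0, 1] makes the point defined for every real t. At the root both summands sit on
  -- the same vertex.
  coord := Finsupp.single x (max 0 (min 1 t)) + Finsupp.single (parent x) (1 - max 0 (min 1 t))
  nonneg y := by
    classical
    have h₁ : max 0 (min 1 t) ≤ 1 := max_le zero_le_one (min_le_left _ _)
    have h₀ : 0 ≤ max 0 (min 1 t) := le_max_left _ _
    rw [Finsupp.add_apply, Finsupp.single_apply, Finsupp.single_apply]
    split_ifs <;> linarith
  sum_eq_one := by
    rw [Finsupp.sum_add_index' (fun _ => rfl) (fun _ _ _ => rfl), Finsupp.sum_single_index rfl,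
      Finsupp.sum_single_index rfl, add_sub_cancel]
  carried := by
    classical
    refine ⟨x, parent x, spans_parent x, fun z hz => ?_⟩
    rcases Finset.mem_union.1 (Finsupp.support_add (Finset.mem_coe.1 hz)) with h | h
    · exact Or.inl (by simpa using Finsupp.support_single_subset h)
    · exact Or.inr (by simpa using Finsupp.support_single_subset h)

theorem edgePt_onSimplex (x : T.V) (t : ℝ) : (edgePt x t).OnSimplex x (parent x) := by
  classical
  intro z hz
  rcases Finset.mem_union.1 (Finsupp.support_add (Finset.mem_coe.1 hz)) with h | h
  · exact Or.inl (by simpa using Finsupp.support_single_subset h)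
  · exact Or.inr (by simpa using Finsupp.support_single_subset h)

theorem parent_ne {x : T.V} (hx : x ≠ T.root) : parent x ≠ x := (adj_parent hx).ne

theorem edgePt_coord {x : T.V} (hx : x ≠ T.root) (t : ℝ) :
    (edgePt x t).coord x = max 0 (min 1 t) := by
  simp [edgePt, Finsupp.single_eq_of_ne' (parent_ne hx)]

theorem edgePt_root (t : ℝ) : edgePt T.root t = vertex T.root := by
  have h := edgePt_onSimplex T.root t
  rw [parent_root] at h
  have h' := vertex_onSimplex_left T.root T.root
  exact h.eq_of_coord_eq h' (by rw [coord_self h, coord_self h'])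

theorem vertex_coord_self (x : T.V) : (vertex x).coord x = 1 := by simp [vertex]

theorem vertex_coord_of_ne {x y : T.V} (h : x ≠ y) : (vertex x).coord y = 0 :=
  Finsupp.single_eq_of_ne' h

theorem edgePt_one (x : T.V) : edgePt x 1 = vertex x := by
  by_cases hx : x = T.root
  · rw [hx, edgePt_root]
  · refine (edgePt_onSimplex x 1).eq_of_coord_eq (vertex_onSimplex_left _ _) ?_
    rw [edgePt_coord hx, vertex_coord_self]
    norm_num

theorem edgePt_zero (x : T.V) : edgePt x 0 = vertex (parent x) := by
  by_cases hx : x = T.root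
  · rw [hx, edgePt_root, parent_root]
  · refine (edgePt_onSimplex x 0).eq_of_coord_eq (vertex_onSimplex_right _ _) ?_
    rw [edgePt_coord hx, vertex_coord_of_ne (parent_ne hx)]
    norm_num

theorem dist_edgePt_le (x : T.V) (s t : ℝ) : dist (edgePt x s) (edgePt x t) ≤ |s - t| := by
  by_cases hx : x = T.root
  · rw [hx, edgePt_root, edgePt_root, dist_self]
    exact abs_nonneg _
  · refine (dist_le_of_onSimplex (spans_parent x) (edgePt_onSimplex x s)
      (edgePt_onSimplex x t)).trans ?_
    rw [edgePt_coord hx, edgePt_coord hx]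
    refine (abs_max_sub_max_le_max _ _ _ _).trans (max_le (by simp) ?_)
    exact (abs_min_sub_min_le_max _ _ _ _).trans (max_le (by simp) le_rfl)

theorem vertex_injective : Function.Injective (vertex : T.V → T.Realization) := by
  intro x y h
  by_contra hxy
  have h₁ := vertex_coord_self x
  rw [h, vertex_coord_of_ne (Ne.symm hxy)] at h₁
  exact zero_ne_one h₁

theorem one_le_dist_vertex {x y : T.V} (h : x ≠ y) : 1 ≤ dist (vertex x) (vertex y) := by
  have := abs_coord_sub_le_dist (vertex x) (vertex y) x
  rwa [vertex_coord_self, vertex_coord_of_ne h.symm, sub_zero, abs_one] at this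

@[simp]
theorem height_vertex (x : T.V) : height (vertex x) = depth x := by
  rw [height, lin_eq _ (vertex_onSimplex_left x x)]
  ring

/-! ## Segments from the root -/

/-- The point at height `t` on the segment from the root to a vertex. -/
noncomputable def seg (x : T.V) (t : ℝ) : T.Realization :=
  -- The edge through height t has its upper end at depth `⌈t⌉₊`. Using the depth of the ancestor
  -- instead of `⌈t⌉₊` gives x itself when t exceeds the depth of x, by the clamping in `edgePt`.
  edgePt (anc x ⌈t⌉₊) (t - depth (anc x ⌈t⌉₊) + 1)

theorem seg_anc (x : T.V) {k : ℕ} {t : ℝ} (h : t ≤ k) : seg (anc x k) t = seg x t := by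
  rw [seg, seg, anc_anc x (Nat.ceil_le.2 h)]

theorem seg_natCast (x : T.V) {n : ℕ} (h : n ≤ depth x) : seg x n = vertex (anc x n) := by
  rw [seg, Nat.ceil_natCast, depth_anc_of_le h, sub_self, zero_add, edgePt_one]

theorem seg_of_mem {x : T.V} {n : ℕ} (h : n + 1 ≤ depth x) {t : ℝ} (h₁ : n ≤ t)
    (h₂ : t ≤ n + 1) : seg x t = edgePt (anc x (n + 1)) (t - n) := by
  -- At t = n the ceiling selects the edge below; the two edges meet in the ancestor of depth n.
  rcases h₁.eq_or_lt with rfl | h₁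
  · rw [seg_natCast x (by omega), sub_self, edgePt_zero, parent_anc x h]
  · have : ⌈t⌉₊ = n + 1 := (Nat.ceil_eq_iff (by simp)).2 ⟨by simpa using h₁, by simpa using h₂⟩
    rw [seg, this, depth_anc_of_le h]
    congr 1
    push_cast
    ring

theorem height_seg {x : T.V} {t : ℝ} (h₀ : 0 ≤ t) (h : t ≤ depth x) : height (seg x t) = t := by
  have hk : ⌈t⌉₊ ≤ depth x := Nat.ceil_le.2 h
  rcases Nat.eq_zero_or_pos ⌈t⌉₊ with h' | h'
  · have : t = ((0 : ℕ) : ℝ) := by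
      have := Nat.ceil_eq_zero.1 h'
      simp
      linarith
    rw [this, seg_natCast x (by omega)]
    simp
  · have hr : anc x ⌈t⌉₊ ≠ T.root := by
      rw [Ne, ← depth_eq_zero, depth_anc_of_le hk]; omega
    have h₁ := Nat.le_ceil t
    have h₂ := Nat.ceil_lt_add_one h₀
    rw [seg, height_eq (edgePt_onSimplex _ _) hr, edgePt_coord hr, depth_anc_of_le hk,
      min_eq_right (by linarith), max_eq_right (by linarith)]
    ring

theorem dist_seg_le_of_le {x : T.V} {s t : ℝ} (h₀ : 0 ≤ s) (hst : s ≤ t) (n : ℕ)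
    (hn : n ≤ depth x) (ht : t ≤ n) : dist (seg x s) (seg x t) ≤ t - s := by
  induction n generalizing s t with
  | zero =>
    have h₁ : s = 0 := by push_cast at ht; linarith
    have h₂ : t = 0 := by push_cast at ht; linarith
    simp [h₁, h₂]
  | succ n ih =>
    have edge : ∀ {s t : ℝ}, (n : ℝ) ≤ s → s ≤ t → t ≤ n + 1 →
        dist (seg x s) (seg x t) ≤ t - s := by
      intro s t hs hst ht
      rw [seg_of_mem hn hs (hst.trans ht), seg_of_mem hn (hs.trans hst) ht]
      refine (dist_edgePt_le _ _ _).trans ?_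
      rw [abs_sub_comm, abs_of_nonneg (by linarith)]
      linarith
    push_cast at ht
    rcases le_total (n : ℝ) s with hs | hs
    · exact edge hs hst ht
    · rcases le_total t n with ht' | ht'
      · exact ih h₀ hst (by omega) ht'
      · have h₁ := ih h₀ hs (by omega) le_rfl
        have h₂ := edge le_rfl ht' ht
        linarith [dist_triangle (seg x s) (seg x n) (seg x t)]

theorem dist_seg_le {x : T.V} {s t : ℝ} (hs₀ : 0 ≤ s) (ht₀ : 0 ≤ t) (hs : s ≤ depth x)
    (ht : t ≤ depth x) : dist (seg x s) (seg x t) ≤ |s - t| := by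
  rcases le_total s t with h | h
  · rw [abs_sub_comm, abs_of_nonneg (by linarith)]
    exact dist_seg_le_of_le hs₀ h _ le_rfl ht
  · rw [abs_of_nonneg (by linarith), dist_comm]
    exact dist_seg_le_of_le ht₀ h _ le_rfl hs

theorem OnSimplex.eq_seg {p : T.Realization} {x : T.V} (hp : p.OnSimplex x (parent x)) :
    p = seg x (height p) := by
  by_cases hx : x = T.root
  · subst hx
    have h₀ : height p = ((0 : ℕ) : ℝ) := by
      have h₁ := height_le hp
      have h₂ := height_nonneg p
      simp at h₁ ⊢
      linarith
    rw [h₀, seg_natCast _ (by simp), anc_zero]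
    rw [parent_root] at hp
    have h' := vertex_onSimplex_left T.root T.root
    exact hp.eq_of_coord_eq h' (by rw [coord_self hp, coord_self h'])
  · obtain ⟨n, hn⟩ : ∃ n, depth x = n + 1 := ⟨_, depth_eq_depth_parent_add_one hx⟩
    have h₁ := depth_sub_one_le_height hp
    have h₂ := height_le hp
    have h₃ := height_eq hp hx
    rw [hn] at h₁ h₂ h₃
    push_cast at h₁ h₂ h₃
    have h₄ : anc x (n + 1) = x := by rw [← hn, anc_depth]
    rw [seg_of_mem hn.ge (by linarith) h₂, h₄]
    refine hp.eq_of_coord_eq (edgePt_onSimplex _ _) ?_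
    rw [edgePt_coord hx, min_eq_right (by linarith), max_eq_right (by linarith)]
    linarith

/-- For t > 0 the point has positive weight at the upper end of its edge. A different vertex of the
same depth is neither end of the other edge, so the weight there would vanish. -/
theorem anc_ceil_eq_of_seg_eq {x y : T.V} {t : ℝ} (h₀ : 0 ≤ t) (hx : t ≤ depth x)
    (hy : t ≤ depth y) (h : seg x t = seg y t) : anc x ⌈t⌉₊ = anc y ⌈t⌉₊ := by
  have hkx : ⌈t⌉₊ ≤ depth x := Nat.ceil_le.2 hx
  have hky : ⌈t⌉₊ ≤ depth y := Nat.ceil_le.2 hy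
  rcases Nat.eq_zero_or_pos ⌈t⌉₊ with h' | h'
  · simp [h']
  · have hr : anc x ⌈t⌉₊ ≠ T.root := by
      rw [Ne, ← depth_eq_zero, depth_anc_of_le hkx]; omega
    by_contra hne
    have hs : (seg y t).OnSimplex (anc y ⌈t⌉₊) (parent (anc y ⌈t⌉₊)) := edgePt_onSimplex _ _
    have hz := coord_eq_zero hs hne (by
      intro e
      have := congrArg depth e
      rw [depth_parent, depth_anc_of_le hkx, depth_anc_of_le hky] at this
      omega)
    rw [← h, seg, edgePt_coord hr, depth_anc_of_le hkx] at hz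
    have h₂ := Nat.ceil_lt_add_one h₀
    have h₃ := le_max_right 0 (min 1 (t - (⌈t⌉₊ : ℝ) + 1))
    rw [hz] at h₃
    rcases min_le_iff.1 h₃ with h₃ | h₃ <;> linarith

theorem seg_eq_seg_of_le {x y : T.V} {s t : ℝ} (h₀ : 0 ≤ t) (hx : t ≤ depth x)
    (hy : t ≤ depth y) (h : seg x t = seg y t) (hs : s ≤ t) : seg x s = seg y s := by
  have hk : s ≤ ⌈t⌉₊ := hs.trans (Nat.le_ceil t)
  rw [← seg_anc x hk, ← seg_anc y hk, anc_ceil_eq_of_seg_eq h₀ hx hy h]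

/-! ## The retractions onto balls around the root -/

/-- The upper end of an edge containing a point. -/
noncomputable def top (p : T.Realization) : T.V := (exists_onSimplex_parent p).choose

theorem onSimplex_top (p : T.Realization) : p.OnSimplex (top p) (parent (top p)) :=
  (exists_onSimplex_parent p).choose_spec

theorem height_le_depth_top (p : T.Realization) : height p ≤ depth (top p) :=
  height_le (onSimplex_top p)

theorem eq_seg_top (p : T.Realization) : p = seg (top p) (height p) := (onSimplex_top p).eq_seg

/-- The retraction onto the points of height at most `s`, along the segments to the root. -/
noncomputable def retract (s : ℝ) (p : T.Realization) : T.Realization :=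
  seg (top p) (min s (height p))

/-- The vertex `top p` is an arbitrary choice when p is a vertex. The retraction does not depend on
it, since segments agreeing at one height agree at all lower heights. -/
theorem retract_eq_seg {p : T.Realization} {x : T.V} (hx : height p ≤ depth x)
    (hp : p = seg x (height p)) (s : ℝ) : retract s p = seg x (min s (height p)) :=
  seg_eq_seg_of_le (height_nonneg p) (height_le_depth_top p) hx
    ((eq_seg_top p).symm.trans hp) (min_le_right _ _)

theorem retract_of_height_le {p : T.Realization} {s : ℝ} (h : height p ≤ s) : retract s p = p := by
  rw [retract, min_eq_right h, ← eq_seg_top]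

theorem height_retract {p : T.Realization} {s : ℝ} (hs : 0 ≤ s) :
    height (retract s p) = min s (height p) :=
  height_seg (le_min hs (height_nonneg p)) ((min_le_right _ _).trans (height_le_depth_top p))

theorem dist_retract_left_le (p : T.Realization) {s t : ℝ} (hs : 0 ≤ s) (ht : 0 ≤ t) :
    dist (retract s p) (retract t p) ≤ |s - t| := by
  have h := height_le_depth_top p
  refine (dist_seg_le (le_min hs (height_nonneg p)) (le_min ht (height_nonneg p))
    ((min_le_right _ _).trans h) ((min_le_right _ _).trans h)).trans ?_
  exact (abs_min_sub_min_le_max _ _ _ _).trans (max_le le_rfl (by simp))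

/-- It suffices to treat one edge. Its points lie on a common segment from the root, where the
retraction truncates the height at s. -/
theorem dist_retract_right_le {s : ℝ} (hs : 0 ≤ s) (p q : T.Realization) :
    dist (retract s p) (retract s q) ≤ dist p q := by
  have key : ∀ (p q : T.Realization) (x : T.V), p.OnSimplex x (parent x) →
      q.OnSimplex x (parent x) → dist (retract s p) (retract s q) ≤ |height p - height q| := by
    intro p q x hp hq
    have h₁ := height_le hp
    have h₂ := height_le hq
    rw [retract_eq_seg h₁ hp.eq_seg, retract_eq_seg h₂ hq.eq_seg]
    refine (dist_seg_le (le_min hs (height_nonneg p)) (le_min hs (height_nonneg q))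
      ((min_le_right _ _).trans h₁) ((min_le_right _ _).trans h₂)).trans ?_
    exact (abs_min_sub_min_le_max _ _ _ _).trans (max_le (by simp) le_rfl)
  refine dist_map_le_of_edges (fun p q x y hxy hp hq => ?_) p q
  have hd : |height p - height q| ≤ |p.coord x - q.coord x| :=
    (dist_height_le p q).trans (dist_le_of_onSimplex hxy hp hq)
  refine le_trans ?_ hd
  rcases spans_iff.1 hxy with rfl | rfl | rfl
  · have : p = q := hp.eq_of_coord_eq hq (by rw [coord_self hp, coord_self hq])
    rw [this]
    simp
  · exact key p q y hp.symm hq.symm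
  · exact key p q x hp hq

theorem continuous_retract {X : Type*} [TopologicalSpace X] {s : X → ℝ} {f : X → T.Realization}
    (hs : Continuous s) (hs₀ : ∀ a, 0 ≤ s a) (hf : Continuous f) :
    Continuous fun a => retract (s a) (f a) := by
  rw [Metric.continuous_iff'] at *
  intro a ε hε
  filter_upwards [hs a (ε / 2) (half_pos hε), hf a (ε / 2) (half_pos hε)] with b h₁ h₂
  have h₃ := dist_retract_left_le (f b) (hs₀ b) (hs₀ a)
  have h₄ := dist_retract_right_le (hs₀ a) (f b) (f a)
  rw [Real.dist_eq] at h₁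
  linarith [dist_triangle (retract (s b) (f b)) (retract (s a) (f b)) (retract (s a) (f a))]

/-- The segment from the root bounds the distance above; the height being 1-Lipschitz bounds it
below. Balls around the root thereby become conditions on heights. -/
theorem dist_root_eq_height (p : T.Realization) : dist T.rootPt p = height p := by
  have hr : height T.rootPt = 0 := by simp [rootPt]
  refine le_antisymm ?_ ?_
  · have h₁ : T.rootPt = seg (top p) ((0 : ℕ) : ℝ) := by
      rw [seg_natCast _ (Nat.zero_le _), anc_zero, rootPt]
    have h₂ := dist_seg_le (x := top p) (s := ((0 : ℕ) : ℝ)) (t := height p) (by simp)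
      (height_nonneg p) (by simp) (height_le_depth_top p)
    rw [← h₁, ← eq_seg_top] at h₂
    simpa [abs_of_nonneg (height_nonneg p)] using h₂
  · have := dist_height_le T.rootPt p
    rwa [hr, Real.dist_eq, zero_sub, abs_neg, abs_of_nonneg (height_nonneg p)] at this

theorem mem_ball_root {p : T.Realization} {r : ℝ} :
    p ∈ Metric.ball T.rootPt r ↔ height p < r := by
  rw [Metric.mem_ball, dist_comm, dist_root_eq_height]

/-! ## Levels -/

/-- The vertex of depth `n` on the segment from the root to a point of height at least `n`. -/
noncomputable def level (n : ℕ) (p : T.Realization) : T.V := anc (top p) n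

theorem retract_natCast {n : ℕ} {p : T.Realization} (h : n ≤ height p) :
    retract n p = vertex (level n p) := by
  rw [retract, min_eq_left h, seg_natCast _ (by exact_mod_cast h.trans (height_le_depth_top p)),
    level]

theorem depth_level {n : ℕ} {p : T.Realization} (h : n ≤ height p) : depth (level n p) = n :=
  depth_anc_of_le (by exact_mod_cast h.trans (height_le_depth_top p))

theorem level_seg {x : T.V} {t : ℝ} {n : ℕ} (hn : n ≤ t) (ht : t ≤ depth x) :
    level n (seg x t) = anc x n := by
  have h₀ : 0 ≤ t := n.cast_nonneg.trans hn
  have hh := height_seg h₀ ht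
  -- Comparing the vertices as points turns the levels into retractions, which are independent of
  -- the choice of `top`.
  apply vertex_injective
  rw [← retract_natCast (hn.trans hh.ge), retract_eq_seg (x := x) (hh.le.trans ht) (by rw [hh]),
    hh, min_eq_left hn, seg_natCast _ (by exact_mod_cast hn.trans ht)]

theorem level_vertex {x : T.V} {n : ℕ} (h : n ≤ depth x) : level n (vertex x) = anc x n := by
  have := level_seg (x := x) (t := depth x) (n := n) (by exact_mod_cast h) le_rfl
  rwa [seg_natCast _ le_rfl, anc_depth] at this

theorem anc_level {m n : ℕ} (h : m ≤ n) (p : T.Realization) : anc (level n p) m = level m p :=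
  anc_anc _ h

/-- Retraction to radius n does not increase distances and yields the two vertices of depth n, while
distinct vertices are at distance at least 1. -/
theorem level_eq_of_dist_lt {n : ℕ} {p q : T.Realization} (hp : n ≤ height p)
    (hq : n ≤ height q) (h : dist p q < 1) : level n p = level n q := by
  by_contra hne
  have h₁ := one_le_dist_vertex hne
  rw [← retract_natCast hp, ← retract_natCast hq] at h₁
  linarith [dist_retract_right_le n.cast_nonneg p q]

theorem retract_eq_of_level_eq {n : ℕ} {p q : T.Realization} (hp : n ≤ height p)
    (hq : n ≤ height q) (h : level n p = level n q) {s : ℝ} (hs : s ≤ n) :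
    retract s p = retract s q := by
  rw [retract, retract, min_eq_left (hs.trans hp), min_eq_left (hs.trans hq),
    ← seg_anc (top p) hs, ← seg_anc (top q) hs]
  exact congrArg (fun x => seg x s) h

/-- Along a connected family of points of height at least `n` the vertex of depth `n` is
constant. -/
theorem level_eq_of_continuousOn {X : Type*} [TopologicalSpace X] {s : Set X}
    (hs : IsPreconnected s) {f : X → T.Realization} (hf : ContinuousOn f s) {n : ℕ}
    (hn : ∀ a ∈ s, n ≤ height (f a)) {a b : X} (ha : a ∈ s) (hb : b ∈ s) :
    level n (f a) = level n (f b) := by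
  have : PreconnectedSpace s := isPreconnected_iff_preconnectedSpace.1 hs
  have hl : IsLocallyConstant fun c : s => level n (f c) := by
    rw [IsLocallyConstant.iff_eventually_eq]
    intro c
    have := Metric.continuous_iff'.1 (continuousOn_iff_continuous_domRestrict.1 hf) c 1 one_pos
    filter_upwards [this] with d hd
    exact level_eq_of_dist_lt (hn _ d.2) (hn _ c.2) hd
  exact hl.apply_eq_of_preconnectedSpace ⟨a, ha⟩ ⟨b, hb⟩

end Realization

end RootedSimplicialTree

/-! ## Step functions -/

/-- The largest `n` with `Ψ n ≤ m`, for a strictly increasing sequence `Ψ` starting at `0`. -/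
def stage (Ψ : ℕ → ℕ) (m : ℕ) : ℕ := Nat.findGreatest (fun n => Ψ n ≤ m) m

/-- Searching only up to m loses nothing, because a strictly increasing Ψ satisfies n ≤ Ψ n. -/
theorem le_stage {Ψ : ℕ → ℕ} (hΨ : StrictMono Ψ) {n m : ℕ} (h : Ψ n ≤ m) : n ≤ stage Ψ m :=
  Nat.le_findGreatest ((hΨ.id_le n).trans h) h

theorem apply_stage_le {Ψ : ℕ → ℕ} (h₀ : Ψ 0 = 0) (m : ℕ) : Ψ (stage Ψ m) ≤ m :=
  Nat.findGreatest_spec (P := fun n => Ψ n ≤ m) (Nat.zero_le m) (by simp [h₀])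

theorem stage_mono {Ψ : ℕ → ℕ} (hΨ : StrictMono Ψ) (h₀ : Ψ 0 = 0) {m m' : ℕ} (h : m ≤ m') : stage Ψ m ≤ stage Ψ m' :=
  le_stage hΨ ((apply_stage_le h₀ m).trans h)

/-- Strictness of Ψ forbids gaining two stages in one step. This is what makes radii 1-Lipschitz and
vertex maps simplicial below. -/
theorem stage_succ_le {Ψ : ℕ → ℕ} (hΨ : StrictMono Ψ) (h₀ : Ψ 0 = 0) (m : ℕ) : stage Ψ (m + 1) ≤ stage Ψ m + 1 := by
  rcases Nat.eq_zero_or_pos (stage Ψ (m + 1)) with h | h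
  · omega
  · obtain ⟨k, hk⟩ : ∃ k, stage Ψ (m + 1) = k + 1 := ⟨_, (Nat.succ_pred_eq_of_pos h).symm⟩
    have h₁ := apply_stage_le h₀ (m + 1)
    rw [hk] at h₁
    have h₂ := hΨ k.lt_succ_self
    have h₃ : k ≤ stage Ψ m := le_stage hΨ (by simp at h₂; omega)
    omega

theorem exists_strictMono_ge (N : ℕ → ℕ) :
    ∃ Ψ : ℕ → ℕ, StrictMono Ψ ∧ Ψ 0 = 0 ∧ ∀ n, 1 ≤ n → N n ≤ Ψ n := by
  -- Positive summands give strictness. The empty sum gives Ψ 0 = 0, so N 0 cannot be dominated and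
  -- is left out.
  refine ⟨fun n => ∑ i ∈ Finset.range n, (N (i + 1) + 1), strictMono_nat_of_lt_succ fun n => ?_,
    by simp, fun n hn => ?_⟩
  · rw [Finset.sum_range_succ]
    omega
  · obtain ⟨k, rfl⟩ : ∃ k, n = k + 1 := ⟨n - 1, by omega⟩
    dsimp only
    rw [Finset.sum_range_succ]
    omega

namespace RootedSimplicialTree

open Realization

/-! ## Metrically proper maps and homotopies in terms of heights -/

theorem isBounded_preimage_of_height {S T : RootedSimplicialTree.{u}}
    {F : S.Realization → T.Realization}
    (h : ∀ n : ℕ, ∃ N : ℕ, ∀ p, N ≤ height p → n ≤ height (F p)) (A : Set T.Realization)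
    (hA : Bornology.IsBounded A) : Bornology.IsBounded (F ⁻¹' A) := by
  obtain ⟨r, hr⟩ := hA.subset_ball T.rootPt
  obtain ⟨n, hn⟩ := exists_nat_ge r
  obtain ⟨N, hN⟩ := h n
  refine (Metric.isBounded_ball (x := S.rootPt) (r := N)).subset fun p hp => ?_
  have h₁ := mem_ball_root.1 (hr hp)
  rw [mem_ball_root]
  by_contra hcon
  linarith [hN p (not_lt.1 hcon)]

theorem MPMap.exists_le_height {S T : RootedSimplicialTree.{u}} (f : MPMap S T) (n : ℕ) :
    ∃ N : ℕ, ∀ p, N ≤ height p → n ≤ height (f.toMap p) := by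
  obtain ⟨r, -, hr⟩ := f.exists_ball n
  obtain ⟨N, hN⟩ := exists_nat_ge r
  refine ⟨N, fun p hp => ?_⟩
  by_contra hcon
  have := mem_ball_root.1 (hr p (mem_ball_root.2 (not_le.1 hcon)))
  linarith

theorem isMPHomotopy_of_height {S T : RootedSimplicialTree.{u}}
    {f g : C(S.Realization, T.Realization)} {H : ContinuousMap.Homotopy f g}
    (h₀ : ∀ t, H (t, S.rootPt) = T.rootPt)
    (h : ∀ n : ℕ, ∃ N : ℕ, ∀ t p, N ≤ height p → n ≤ height (H (t, p))) : IsMPHomotopy H := by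
  refine ⟨h₀, fun M _ => ?_⟩
  obtain ⟨n, hn⟩ := exists_nat_ge M
  obtain ⟨N, hN⟩ := h n
  refine ⟨N + 1, by positivity, fun t p hp => ?_⟩
  rw [mem_ball_root] at hp ⊢
  by_contra hcon
  linarith [hN t p (by linarith)]

@[simp]
theorem height_rootPt {T : RootedSimplicialTree.{u}} : height T.rootPt = 0 := by simp [rootPt]

namespace MPMap

variable {S T : RootedSimplicialTree.{u}}

/-- The segment from p down to its ancestor of depth N stays at height at least N, so its image is
connected and stays at height at least n. -/
theorem level_eq_level_vertex (f : MPMap S T) {n N : ℕ}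
    (h : ∀ p, N ≤ height p → n ≤ height (f.toMap p)) {p : S.Realization} (hp : N ≤ height p) :
    level n (f.toMap p) = level n (f.toMap (vertex (level N p))) := by
  have hs : ∀ t ∈ Set.Icc (N : ℝ) (height p), 0 ≤ t ∧ t ≤ depth (top p) := fun t ht =>
    ⟨N.cast_nonneg.trans ht.1, ht.2.trans (height_le_depth_top p)⟩
  have hc : ContinuousOn (seg (top p)) (Set.Icc (N : ℝ) (height p)) :=
    (LipschitzOnWith.of_dist_le_mul (K := 1) fun s hs' t ht' => by
      simpa [Real.dist_eq] using
        dist_seg_le (hs s hs').1 (hs t ht').1 (hs s hs').2 (hs t ht').2).continuousOn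
  have := level_eq_of_continuousOn isPreconnected_Icc (f := fun t => f.toMap (seg (top p) t))
    (f.toMap.continuous.comp_continuousOn hc)
    (fun t ht => h _ (by rw [height_seg (hs t ht).1 (hs t ht).2]; exact ht.1))
    (Set.right_mem_Icc.2 hp) (Set.left_mem_Icc.2 hp)
  rwa [← eq_seg_top, seg_natCast _ (by exact_mod_cast hp.trans (height_le_depth_top p))] at this

/-- The map followed by the retractions onto balls with variable radius. -/
noncomputable def retractMap (f : MPMap S T) (ρ : S.Realization → ℝ) (hρ : Continuous ρ)
    (hρ₀ : ∀ p, 0 ≤ ρ p) (hρ' : ∀ n : ℕ, ∃ N : ℕ, ∀ p, N ≤ height p → n ≤ ρ p) :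
    MPMap S T where
  toMap := ⟨fun p => retract (ρ p) (f.toMap p), continuous_retract hρ hρ₀ f.toMap.continuous⟩
  map_root := by
    change retract _ (f.toMap S.rootPt) = _
    rw [f.map_root, retract_of_height_le (by rw [height_rootPt]; exact hρ₀ _)]
  proper := isBounded_preimage_of_height fun n => by
    obtain ⟨N, hN⟩ := f.exists_le_height n
    obtain ⟨N', hN'⟩ := hρ' n
    refine ⟨max N N', fun p hp => ?_⟩
    rw [Nat.cast_max] at hp
    change _ ≤ height (retract _ _)
    rw [height_retract (hρ₀ p)]
    exact le_min (hN' p ((le_max_right _ _).trans hp)) (hN p ((le_max_left _ _).trans hp))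

/-- The radius slides linearly from the height of f(p), where the retraction does nothing, to ρ(p).
Both ends tend to infinity with the height of p, which keeps the homotopy proper. -/
theorem homotopic_retractMap (f : MPMap S T) (ρ : S.Realization → ℝ) (hρ : Continuous ρ)
    (hρ₀ : ∀ p, 0 ≤ ρ p) (hρ' : ∀ n : ℕ, ∃ N : ℕ, ∀ p, N ≤ height p → n ≤ ρ p) :
    f ≈ f.retractMap ρ hρ hρ₀ hρ' := by
  have hpos : ∀ a : unitInterval × S.Realization,
      0 ≤ (1 - (a.1 : ℝ)) * height (f.toMap a.2) + a.1 * ρ a.2 := fun a =>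
    add_nonneg (mul_nonneg (sub_nonneg.2 a.1.2.2) (height_nonneg _))
      (mul_nonneg a.1.2.1 (hρ₀ _))
  have hc : Continuous fun a : unitInterval × S.Realization =>
      retract ((1 - (a.1 : ℝ)) * height (f.toMap a.2) + a.1 * ρ a.2) (f.toMap a.2) := by
    refine continuous_retract ?_ hpos (by fun_prop)
    have := continuous_height (T := T)
    fun_prop
  refine ⟨⟨⟨_, hc⟩, fun p => ?_, fun p => ?_⟩, isMPHomotopy_of_height (fun t => ?_) fun n => ?_⟩
  · exact retract_of_height_le (by simp)
  · simp [retractMap]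
  · change retract _ (f.toMap S.rootPt) = _
    have := hpos (t, S.rootPt)
    dsimp only at this
    rw [f.map_root] at this ⊢
    exact retract_of_height_le (by rwa [height_rootPt] at this ⊢)
  · obtain ⟨N, hN⟩ := f.exists_le_height n
    obtain ⟨N', hN'⟩ := hρ' n
    refine ⟨max N N', fun t p hp => ?_⟩
    rw [Nat.cast_max] at hp
    change _ ≤ height (retract _ _)
    rw [height_retract (hpos (t, p))]
    have h₁ := hN' p ((le_max_right _ _).trans hp)
    have h₂ := hN p ((le_max_left _ _).trans hp)
    refine le_min ?_ h₂
    have h₃ := mul_le_mul_of_nonneg_left h₂ (sub_nonneg.2 t.2.2)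
    have h₄ := mul_le_mul_of_nonneg_left h₁ t.2.1
    dsimp only
    linarith

theorem homotopic_of_retract_eq {f g : MPMap S T} (ρ : S.Realization → ℝ) (hρ : Continuous ρ)
    (hρ₀ : ∀ p, 0 ≤ ρ p) (hρ' : ∀ n : ℕ, ∃ N : ℕ, ∀ p, N ≤ height p → n ≤ ρ p)
    (h : ∀ p, retract (ρ p) (f.toMap p) = retract (ρ p) (g.toMap p)) : f ≈ g := by
  have h₁ := homotopic_retractMap f ρ hρ hρ₀ hρ'
  have h₂ := homotopic_retractMap g ρ hρ hρ₀ hρ'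
  have h₃ : f.retractMap ρ hρ hρ₀ hρ' = g.retractMap ρ hρ hρ₀ hρ' := by
    simp only [retractMap, h]
  exact Setoid.trans h₁ (h₃ ▸ Setoid.symm h₂)

end MPMap

/-- There are continuous functions tending to infinity with the height arbitrarily slowly. -/
theorem exists_continuous_radius {S : RootedSimplicialTree.{u}} (N : ℕ → ℕ) :
    ∃ ρ : S.Realization → ℝ, Continuous ρ ∧ (∀ p, 0 ≤ ρ p) ∧
      (∀ n : ℕ, ∃ N : ℕ, ∀ p, N ≤ height p → n ≤ ρ p) ∧
      ∀ p, ∃ n : ℕ, ρ p ≤ n ∧ (n = 0 ∨ N n ≤ height p) := by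
  -- The extra 1 pays for p lying up to 1 below the upper end of its edge, at whose depth the stage
  -- is read off.
  obtain ⟨Ψ, hΨ, h₀, hN⟩ := exists_strictMono_ge fun n => N n + 1
  have hval : ∀ p : S.Realization, ∃ t : ℝ, 0 ≤ t ∧ t ≤ 1 ∧
      lin (fun x => (stage Ψ (depth x) : ℝ)) p =
        t * stage Ψ (depth (top p)) + (1 - t) * stage Ψ (depth (parent (top p))) := fun p =>
    ⟨_, p.nonneg _, coord_le_one (onSimplex_top p), lin_eq _ (onSimplex_top p)⟩
  have hmono : ∀ x : S.V, stage Ψ (depth (parent x)) ≤ stage Ψ (depth x) := fun x =>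
    stage_mono hΨ h₀ (by rw [depth_parent]; omega)
  have hstep : ∀ x : S.V, |(stage Ψ (depth x) : ℝ) - stage Ψ (depth (parent x))| ≤ 1 := by
    intro x
    have h₁ : stage Ψ (depth x) ≤ stage Ψ (depth (parent x)) + 1 := by
      by_cases hx : x = S.root
      · simp [hx]
      · rw [depth_eq_depth_parent_add_one hx]
        exact stage_succ_le hΨ h₀ _
    have h₂ := hmono x
    rify at h₁ h₂
    rw [abs_le]
    constructor <;> linarith
  -- The radius interpolates the stage of the depth. At height Ψ n + 1 both ends of the edge have
  -- depth at least Ψ n, hence stage at least n.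
  refine ⟨lin fun x => (stage Ψ (depth x) : ℝ), continuous_lin fun x y h => ?_, fun p => ?_,
    fun n => ⟨Ψ n + 1, fun p hp => ?_⟩, fun p => ⟨stage Ψ (depth (top p)), ?_, ?_⟩⟩
  · rcases spans_iff.1 h with rfl | rfl | rfl
    · simp
    · rw [abs_sub_comm]
      exact hstep y
    · exact hstep x
  · exact Finset.sum_nonneg fun x _ => mul_nonneg (p.nonneg x) (Nat.cast_nonneg _)
  · obtain ⟨t, ht₀, ht₁, h⟩ := hval p
    have h₁ : Ψ n + 1 ≤ depth (top p) := by exact_mod_cast hp.trans (height_le_depth_top p)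
    have h₂ : n ≤ stage Ψ (depth (parent (top p))) :=
      le_stage hΨ (by rw [depth_parent]; omega)
    have h₃ := hmono (top p)
    rify at h₂ h₃
    rw [h]
    nlinarith
  · obtain ⟨t, ht₀, ht₁, h⟩ := hval p
    have h₃ := hmono (top p)
    rify at h₃
    rw [h]
    nlinarith
  · rcases Nat.eq_zero_or_pos (stage Ψ (depth (top p))) with h | h
    · exact Or.inl h
    · right
      have h₁ := (hN _ h).trans (apply_stage_le h₀ (depth (top p)))
      have h₂ := depth_sub_one_le_height (onSimplex_top p)
      rify at h₁
      linarith

/-! ### A homotopy criterion on deep vertices -/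

namespace MPMap

variable {S T : RootedSimplicialTree.{u}}

/-- Two maps are homotopic if, for every `n`, they send every sufficiently deep vertex to points
above the same vertex of depth `n`. -/
theorem homotopic_of_level_eq {f g : MPMap S T}
    (h : ∀ n : ℕ, ∃ N : ℕ, ∀ x : S.V, N ≤ depth x →
      level n (f.toMap (vertex x)) = level n (g.toMap (vertex x))) : f ≈ g := by
  have key : ∀ n : ℕ, ∃ N : ℕ, ∀ p : S.Realization, N ≤ height p → n ≤ height (f.toMap p) ∧
      n ≤ height (g.toMap p) ∧ level n (f.toMap p) = level n (g.toMap p) := by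
    intro n
    obtain ⟨N, hN⟩ := h n
    obtain ⟨Nf, hf⟩ := f.exists_le_height n
    obtain ⟨Ng, hg⟩ := g.exists_le_height n
    have hf' : ∀ p, ((max N (max Nf Ng) : ℕ) : ℝ) ≤ height p → n ≤ height (f.toMap p) :=
      fun p hp => hf p (le_trans (by simp) hp)
    have hg' : ∀ p, ((max N (max Nf Ng) : ℕ) : ℝ) ≤ height p → n ≤ height (g.toMap p) :=
      fun p hp => hg p (le_trans (by simp) hp)
    refine ⟨max N (max Nf Ng), fun p hp => ⟨hf' p hp, hg' p hp, ?_⟩⟩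
    rw [level_eq_level_vertex f hf' hp, level_eq_level_vertex g hg' hp]
    exact hN _ (by rw [depth_level hp]; exact le_max_left _ _)
  choose N hN using key
  -- This radius is at most n only where f(p) and g(p) are known to share their vertex of depth n,
  -- so both retract to the same point; for n = 0 the shared vertex is the root.
  obtain ⟨ρ, hρ, hρ₀, hρ', hρN⟩ := exists_continuous_radius (S := S) N
  refine homotopic_of_retract_eq ρ hρ hρ₀ hρ' fun p => ?_
  obtain ⟨n, hn, hn' | hn'⟩ := hρN p
  · subst hn'
    refine retract_eq_of_level_eq (n := 0) (by simpa using height_nonneg _)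
      (by simpa using height_nonneg _) ?_ hn
    rw [level, level, anc_zero, anc_zero]
  · obtain ⟨h₁, h₂, h₃⟩ := hN n p hn'
    exact retract_eq_of_level_eq h₁ h₂ h₃ hn

/-! ## Maps induced by maps of vertices -/

/-- The map of realizations induced by a map of vertices sending simplices to simplices. -/
noncomputable def _root_.RootedSimplicialTree.Realization.mapVertices (φ : S.V → T.V)
    (hφ : ∀ x y, S.Spans x y → T.Spans (φ x) (φ y)) (p : S.Realization) : T.Realization where
  coord := p.coord.mapDomain φ
  nonneg y := by
    rw [Finsupp.mapDomain, Finsupp.sum_apply]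
    refine Finset.sum_nonneg fun x _ => ?_
    classical
    dsimp only
    rw [Finsupp.single_apply]
    split_ifs
    · exact p.nonneg x
    · exact le_rfl
  sum_eq_one := by
    rw [Finsupp.sum_mapDomain_index (fun _ => rfl) (fun _ _ _ => rfl), p.sum_eq_one]
  carried := by
    classical
    obtain ⟨x, y, hxy, hp⟩ := p.carried
    refine ⟨φ x, φ y, hφ x y hxy, fun z hz => ?_⟩
    obtain ⟨w, hw, rfl⟩ := Finset.mem_image.1 (Finsupp.mapDomain_support (Finset.mem_coe.1 hz))
    rcases hp (Finset.mem_coe.2 hw) with rfl | h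
    · exact Or.inl rfl
    · rw [Set.mem_singleton_iff.1 h]
      exact Or.inr rfl

section mapVertices

variable {φ : S.V → T.V} {hφ : ∀ x y, S.Spans x y → T.Spans (φ x) (φ y)}

theorem mapVertices_vertex (x : S.V) : mapVertices φ hφ (vertex x) = vertex (φ x) :=
  Realization.ext Finsupp.mapDomain_single

theorem lin_mapVertices (F : T.V → ℝ) (p : S.Realization) :
    lin F (mapVertices φ hφ p) = lin (fun x => F (φ x)) p :=
  Finsupp.sum_mapDomain_index (fun _ => zero_mul _) (fun _ _ _ => add_mul _ _ _)

theorem mapVertices_onSimplex {p : S.Realization} {x y : S.V} (hp : p.OnSimplex x y) :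
    (mapVertices φ hφ p).OnSimplex (φ x) (φ y) := by
  classical
  intro z hz
  obtain ⟨w, hw, rfl⟩ := Finset.mem_image.1 (Finsupp.mapDomain_support (Finset.mem_coe.1 hz))
  rcases hp (Finset.mem_coe.2 hw) with rfl | h
  · exact Or.inl rfl
  · rw [Set.mem_singleton_iff.1 h]
    exact Or.inr rfl

theorem mapVertices_coord {p : S.Realization} {x y : S.V} (hp : p.OnSimplex x y)
    (h : φ x ≠ φ y) : (mapVertices φ hφ p).coord (φ x) = p.coord x := by
  classical
  -- Extending the indicator function of φ x linearly reads off the coordinate at φ x.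
  have h₁ := lin_mapVertices (hφ := hφ) (fun z => if z = φ x then 1 else 0) p
  rw [lin_eq _ hp, lin_eq _ (mapVertices_onSimplex (hφ := hφ) hp)] at h₁
  simpa [h.symm] using h₁

theorem dist_mapVertices_le (p q : S.Realization) :
    dist (mapVertices φ hφ p) (mapVertices φ hφ q) ≤ dist p q := by
  refine dist_map_le_of_edges (fun p q x y hxy hp hq => ?_) p q
  have hp' := mapVertices_onSimplex (hφ := hφ) hp
  have hq' := mapVertices_onSimplex (hφ := hφ) hq
  by_cases h : φ x = φ y
  · rw [← h] at hp' hq'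
    have : mapVertices φ hφ p = mapVertices φ hφ q :=
      hp'.eq_of_coord_eq hq' (by rw [coord_self hp', coord_self hq'])
    rw [this, dist_self]
    exact abs_nonneg _
  · refine (dist_le_of_onSimplex (hφ x y hxy) hp' hq').trans ?_
    rw [mapVertices_coord hp h, mapVertices_coord hq h]

end mapVertices

/-- The metrically proper map induced by a map of vertices. -/
noncomputable def ofVertices (φ : S.V → T.V) (hφ : ∀ x y, S.Spans x y → T.Spans (φ x) (φ y))
    (hroot : φ S.root = T.root)
    (hproper : ∀ n : ℕ, ∃ N : ℕ, ∀ x, N ≤ depth x → n ≤ depth (φ x)) : MPMap S T where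
  toMap := ⟨mapVertices φ hφ, (LipschitzWith.of_dist_le_mul (K := 1) fun p q => by
    simpa using dist_mapVertices_le (hφ := hφ) p q).continuous⟩
  map_root := by
    change mapVertices φ hφ (vertex S.root) = vertex T.root
    rw [mapVertices_vertex, hroot]
  proper := isBounded_preimage_of_height fun n => by
    obtain ⟨N, hN⟩ := hproper n
    refine ⟨N + 1, fun p hp => ?_⟩
    change (n : ℝ) ≤ lin _ (mapVertices φ hφ p)
    have h₁ : N + 1 ≤ depth (top p) := by exact_mod_cast hp.trans (height_le_depth_top p)
    rw [lin_mapVertices, lin_eq _ (onSimplex_top p)]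
    have h₂ := hN (top p) (by omega)
    have h₃ := hN (parent (top p)) (by rw [depth_parent]; omega)
    rify at h₂ h₃
    nlinarith [p.nonneg (top p), coord_le_one (onSimplex_top p)]

variable {φ : S.V → T.V} {hφ : ∀ x y, S.Spans x y → T.Spans (φ x) (φ y)}
  {hroot : φ S.root = T.root} {hproper : ∀ n : ℕ, ∃ N : ℕ, ∀ x, N ≤ depth x → n ≤ depth (φ x)}

theorem ofVertices_vertex (x : S.V) :
    (ofVertices φ hφ hroot hproper).toMap (vertex x) = vertex (φ x) := mapVertices_vertex (hφ := hφ) x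

theorem isSimplicial_ofVertices : (ofVertices φ hφ hroot hproper).IsSimplicial :=
  ⟨φ, hφ, fun _ => rfl⟩

theorem preservesRootDist_ofVertices (h : ∀ x, depth (φ x) = depth x) :
    (ofVertices φ hφ hroot hproper).PreservesRootDist := by
  intro p
  rw [dist_root_eq_height, dist_root_eq_height]
  change lin _ (mapVertices φ hφ p) = _
  rw [lin_mapVertices]
  simp only [h]
  rfl

end MPMap

end RootedSimplicialTree

namespace RootedSimplicialTree

open Realization

/-! ## The inverse sequence of the levels of a tree -/

/-- The inverse sequence of the sets of vertices of given depth. -/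
noncomputable def levels (T : RootedSimplicialTree.{u}) : TowerSet.{u} where
  obj n := {x : T.V // depth x = n}
  bond h x := ⟨anc x.1 _, depth_anc_of_le (h.trans x.2.ge)⟩
  bond_refl _ x := Subtype.ext (anc_of_depth_le x.2.le)
  bond_bond h _ x := Subtype.ext (anc_anc x.1 h)

/-- The vertex at the `n`-th level of the target to which a morphism of sequences sends the part
of the source above a vertex; the root if the vertex is not deep enough. -/
noncomputable def push {S T : RootedSimplicialTree.{u}}
    (a : TowerSet.SeqHom (levels S) (levels T)) (n : ℕ) (x : S.V) : T.V :=
  if h : a.idx n ≤ depth x then (a.map n ⟨anc x (a.idx n), depth_anc_of_le h⟩).1 else T.root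

section Push

variable {R S T : RootedSimplicialTree.{u}} (a : TowerSet.SeqHom (levels S) (levels T))

theorem push_of_le {n : ℕ} {x : S.V} (h : a.idx n ≤ depth x) :
    push a n x = (a.map n ⟨anc x (a.idx n), depth_anc_of_le h⟩).1 := dif_pos h

theorem depth_push {n : ℕ} {x : S.V} (h : a.idx n ≤ depth x) : depth (push a n x) = n := by
  rw [push_of_le a h]
  exact (a.map n _).2

theorem push_zero (x : S.V) : push a 0 x = T.root := by
  rw [push]
  split_ifs with h
  · exact depth_eq_zero.1 (a.map 0 _).2
  · rfl

theorem push_anc {n k : ℕ} {x : S.V} (h : a.idx n ≤ k) (hk : k ≤ depth x) :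
    push a n (anc x k) = push a n x := by
  rw [push_of_le a (h.trans hk), push_of_le a (h.trans (depth_anc_of_le hk).ge)]
  congr 3
  exact anc_anc x h

theorem push_eq_map {n m : ℕ} (h : a.idx n ≤ m) (x : (levels S).obj m) :
    push a n x.1 = (a.map n ((levels S).bond h x)).1 := push_of_le a (h.trans x.2.ge)

/-- Coherence is given on a single level N; it passes to all deeper vertices because `push` depends
only on the ancestor at depth N. -/
theorem exists_anc_push {m n : ℕ} (h : m ≤ n) :
    ∃ N, ∀ x : S.V, N ≤ depth x → anc (push a n x) m = push a m x := by
  obtain ⟨N, h₁, h₂, e⟩ := a.coherent h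
  refine ⟨N, fun x hx => ?_⟩
  have hx' : depth (anc x N) = N := depth_anc_of_le hx
  have : push a m (anc x N) = anc (push a n (anc x N)) m :=
    (push_eq_map a h₁ ⟨_, hx'⟩).trans ((congrArg Subtype.val (e ⟨_, hx'⟩)).trans
      (congrArg (fun y => anc y m) (push_eq_map a h₂ ⟨_, hx'⟩).symm))
  rw [push_anc a h₁ hx, push_anc a h₂ hx] at this
  exact this.symm

/-- Equality in the category of towers becomes agreement on all sufficiently deep vertices, with no
bonding maps or index functions to compare. -/
theorem equiv_iff_push {a b : TowerSet.SeqHom (levels S) (levels T)} :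
    a ≈ b ↔ ∀ n, ∃ N, ∀ x : S.V, N ≤ depth x → push a n x = push b n x := by
  constructor
  · intro h n
    obtain ⟨N, h₁, h₂, e⟩ := h n
    refine ⟨N, fun x hx => ?_⟩
    have hx' : depth (anc x N) = N := depth_anc_of_le hx
    have : push a n (anc x N) = push b n (anc x N) :=
      (push_eq_map a h₁ ⟨_, hx'⟩).trans ((congrArg Subtype.val (e ⟨_, hx'⟩)).trans
        (push_eq_map b h₂ ⟨_, hx'⟩).symm)
    rwa [push_anc a h₁ hx, push_anc b h₂ hx] at this
  · intro h n
    obtain ⟨N, hN⟩ := h n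
    have h₁ : a.idx n ≤ max N (max (a.idx n) (b.idx n)) := by simp
    have h₂ : b.idx n ≤ max N (max (a.idx n) (b.idx n)) := by simp
    refine ⟨_, h₁, h₂, fun x => Subtype.ext ?_⟩
    rw [← push_eq_map, ← push_eq_map]
    exact hN _ (by rw [x.2]; exact le_max_left _ _)

theorem push_comp (b : TowerSet.SeqHom (levels R) (levels S)) {n : ℕ} {x : R.V}
    (h : b.idx (a.idx n) ≤ depth x) :
    push (b.comp a) n x = push a n (push b (a.idx n) x) := by
  have h' : (b.comp a).idx n ≤ depth x := h
  have h₁ := depth_push b h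
  rw [push_of_le _ h', push_of_le a h₁.ge]
  change (a.map n (b.map (a.idx n) _)).1 = _
  congr 2
  refine Subtype.ext ?_
  dsimp only
  rw [anc_of_depth_le h₁.le, push_of_le b h]
  rfl

theorem push_id {n : ℕ} {x : S.V} (h : n ≤ depth x) :
    push (TowerSet.SeqHom.id (levels S)) n x = anc x n := push_of_le _ h

/-- A morphism of sequences can be evaluated coherently at vertices of sufficiently large
depth. -/
theorem exists_strictMono_push : ∃ Ψ : ℕ → ℕ, StrictMono Ψ ∧ Ψ 0 = 0 ∧
    (∀ n, 1 ≤ n → a.idx n ≤ Ψ n) ∧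
    ∀ m n, m ≤ n → ∀ x : S.V, Ψ n ≤ depth x → anc (push a n x) m = push a m x := by
  have hex : ∀ n m, ∃ N, ∀ x : S.V, m ≤ n → N ≤ depth x → anc (push a n x) m = push a m x := by
    intro n m
    by_cases h : m ≤ n
    · obtain ⟨N, hN⟩ := exists_anc_push a h
      exact ⟨N, fun x _ => hN x⟩
    · exact ⟨0, fun x h' => absurd h' h⟩
  choose N hN using hex
  obtain ⟨Ψ, hΨ, h₀, hΨN⟩ :=
    -- The sum dominates the finitely many thresholds for m ≤ n at once.
    exists_strictMono_ge fun n => a.idx n + ∑ m ∈ Finset.range (n + 1), N n m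
  refine ⟨Ψ, hΨ, h₀, fun n hn => (Nat.le_add_right _ _).trans (hΨN n hn), ?_⟩
  intro m n hmn x hx
  rcases Nat.eq_zero_or_pos n with rfl | hn
  · obtain rfl : m = 0 := by omega
    rw [push_zero, anc_zero]
  · refine hN n m x hmn (le_trans ?_ ((hΨN n hn).trans hx))
    exact (Finset.single_le_sum (f := N n) (fun _ _ => Nat.zero_le _)
      (Finset.mem_range.2 (by omega))).trans (Nat.le_add_left _ _)

end Push

/-! ### Morphisms of sequences induced by metrically proper maps -/

namespace MPMap

variable {R S T : RootedSimplicialTree.{u}}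

/-- A morphism of sequences describes the effect of a metrically proper map on deep vertices. -/
def Induces (f : MPMap S T) (a : TowerSet.SeqHom (levels S) (levels T)) : Prop :=
  ∀ n, ∃ N, ∀ x : S.V, N ≤ depth x → level n (f.toMap (vertex x)) = push a n x

theorem Induces.equiv {f : MPMap S T} {a b : TowerSet.SeqHom (levels S) (levels T)}
    (ha : f.Induces a) (hb : f.Induces b) : a ≈ b := by
  refine equiv_iff_push.2 fun n => ?_
  obtain ⟨N, hN⟩ := ha n
  obtain ⟨N', hN'⟩ := hb n
  exact ⟨max N N', fun x hx => (hN x ((le_max_left _ _).trans hx)).symm.trans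
    (hN' x ((le_max_right _ _).trans hx))⟩

theorem Induces.of_equiv {f : MPMap S T} {a b : TowerSet.SeqHom (levels S) (levels T)}
    (ha : f.Induces a) (h : a ≈ b) : f.Induces b := by
  intro n
  obtain ⟨N, hN⟩ := ha n
  obtain ⟨N', hN'⟩ := equiv_iff_push.1 h n
  exact ⟨max N N', fun x hx => (hN x ((le_max_left _ _).trans hx)).trans
    (hN' x ((le_max_right _ _).trans hx))⟩

theorem Induces.homotopic {f g : MPMap S T} {a : TowerSet.SeqHom (levels S) (levels T)}
    (hf : f.Induces a) (hg : g.Induces a) : f ≈ g := by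
  refine homotopic_of_level_eq fun n => ?_
  obtain ⟨N, hN⟩ := hf n
  obtain ⟨N', hN'⟩ := hg n
  exact ⟨max N N', fun x hx => (hN x ((le_max_left _ _).trans hx)).trans
    (hN' x ((le_max_right _ _).trans hx)).symm⟩

/-- During the homotopy the image of a deep vertex stays at height at least n, so along this
connected track the vertex of depth n cannot change. -/
theorem Induces.of_homotopic {f g : MPMap S T} {a : TowerSet.SeqHom (levels S) (levels T)}
    (hf : f.Induces a) (h : f ≈ g) : g.Induces a := by
  intro n
  obtain ⟨H, -, hH⟩ := h
  obtain ⟨N, hN⟩ := hf n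
  -- Radius n + 1 rather than n, since a positive radius is required also for n = 0.
  obtain ⟨r, -, hr⟩ := hH (n + 1) (by positivity)
  obtain ⟨N', hN'⟩ := exists_nat_ge r
  refine ⟨max N N', fun x hx => ?_⟩
  rw [← hN x ((le_max_left _ _).trans hx)]
  have hx' : N' ≤ depth x := (le_max_right _ _).trans hx
  rify at hx'
  have hge : ∀ t, (n : ℝ) ≤ height (H (t, vertex x)) := by
    intro t
    by_contra hcon
    have := mem_ball_root.1 (hr t (vertex x) (mem_ball_root.2 (by linarith)))
    rw [height_vertex] at this
    linarith
  have := level_eq_of_continuousOn (n := n) isPreconnected_univ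
    (f := fun t : unitInterval => H (t, vertex x)) (by fun_prop) (fun t _ => hge t)
    (Set.mem_univ 1) (Set.mem_univ 0)
  simpa using this

/-- The image of a deep vertex x under f need not be a vertex, whereas b describes g on vertices
only. It is replaced by its ancestor of depth m, large enough for g to see no difference at level n.
-/
theorem Induces.comp {f : MPMap R S} {g : MPMap S T}
    {a : TowerSet.SeqHom (levels R) (levels S)} {b : TowerSet.SeqHom (levels S) (levels T)}
    (hf : f.Induces a) (hg : g.Induces b) : (f.comp g).Induces (a.comp b) := by
  intro n
  obtain ⟨K, hK⟩ := g.exists_le_height n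
  obtain ⟨N, hN⟩ := hg n
  obtain ⟨N', hN'⟩ := hf (b.idx n)
  let m := max K (max N (b.idx n))
  obtain ⟨M, hM⟩ := f.exists_le_height m
  refine ⟨max M (max N' (a.idx (b.idx n))), fun x hx => ?_⟩
  have hx₁ : M ≤ depth x := (le_max_left _ _).trans hx
  have hx₂ : N' ≤ depth x := le_trans (by simp) hx
  have hx₃ : a.idx (b.idx n) ≤ depth x := le_trans (by simp) hx
  have hm := hM (vertex x) (by rw [height_vertex]; exact_mod_cast hx₁)
  have hK' : ∀ p : S.Realization, (m : ℝ) ≤ height p → (n : ℝ) ≤ height (g.toMap p) :=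
    fun p hp => hK p (le_trans (by exact_mod_cast le_max_left _ _) hp)
  have hb : b.idx n ≤ m := by simp [m]
  have hd := depth_level hm
  rw [push_comp b a hx₃, ← hN' x hx₂]
  change level n (g.toMap (f.toMap (vertex x))) = _
  rw [level_eq_level_vertex g hK' hm, hN _ (by rw [hd]; simp [m]),
    ← push_anc b le_rfl (hb.trans hd.ge), anc_level hb]

theorem induces_id : (MPMap.id S).Induces (TowerSet.SeqHom.id (levels S)) := fun n =>
  ⟨n, fun x hx => by
    rw [push_id hx]
    exact level_vertex hx⟩

/-- The index function is the modulus of properness N. Coherence holds because, for a vertex deep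
enough for both n and n', the two values are ancestors of one and the same image point. -/
theorem exists_induces (f : MPMap S T) : ∃ a, f.Induces a := by
  choose N hN using f.exists_le_height
  have hd : ∀ n (x : (levels S).obj (N n)), (n : ℝ) ≤ height (f.toMap (vertex x.1)) :=
    fun n x => hN n _ (by rw [height_vertex, x.2])
  have hl : ∀ n (x : S.V), N n ≤ depth x →
      level n (f.toMap (vertex x)) = level n (f.toMap (vertex (anc x (N n)))) := by
    intro n x hx
    rw [level_eq_level_vertex f (hN n) (by rw [height_vertex]; exact_mod_cast hx),
      level_vertex hx]
  refine ⟨⟨N, fun n x => ⟨level n (f.toMap (vertex x.1)), depth_level (hd n x)⟩, ?_⟩, ?_⟩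
  · intro n n' h
    refine ⟨max (N n) (N n'), le_max_left _ _, le_max_right _ _, fun x => Subtype.ext ?_⟩
    change level n (f.toMap (vertex (anc x.1 (N n)))) =
      anc (level n' (f.toMap (vertex (anc x.1 (N n'))))) n
    rw [← hl n _ (by rw [x.2]; exact le_max_left _ _),
      ← hl n' _ (by rw [x.2]; exact le_max_right _ _), anc_level h]
  · intro n
    refine ⟨N n, fun x hx => ?_⟩
    rw [push_of_le _ hx, hl n x hx]

end MPMap

/-- A map of vertices sending every vertex and its parent to a simplex is simplicial. -/
theorem spans_map_of_parent {S T : RootedSimplicialTree.{u}} {φ : S.V → T.V}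
    (h : ∀ x, φ (parent x) = φ x ∨ φ (parent x) = parent (φ x)) (x y : S.V)
    (hxy : S.Spans x y) : T.Spans (φ x) (φ y) := by
  rw [spans_iff] at *
  rcases hxy with rfl | rfl | rfl
  · exact Or.inl rfl
  · rcases h y with h | h <;> simp [h]
  · rcases h x with h | h <;> simp [h]

/-- A vertex x goes to its value at level `stage Ψ (depth x)`, for Ψ growing so fast that all values
up to this level are coherent. Between a parent and its child the level stays the same or rises by
one, so edges go to vertices or edges. -/
theorem exists_mpMap_induces {S T : RootedSimplicialTree.{u}}
    (a : TowerSet.SeqHom (levels S) (levels T)) : ∃ f : MPMap S T, f.Induces a := by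
  obtain ⟨Ψ, hΨ, h₀, hidx, hanc⟩ := exists_strictMono_push a
  have hd : ∀ n (x : S.V), Ψ n ≤ depth x → depth (push a n x) = n := by
    intro n x hx
    rcases Nat.eq_zero_or_pos n with rfl | hn
    · rw [push_zero, depth_root]
    · exact depth_push a ((hidx n hn).trans hx)
  have hpar : ∀ n (x : S.V), Ψ n ≤ depth (parent x) → push a n (parent x) = push a n x := by
    intro n x hx
    rcases Nat.eq_zero_or_pos n with rfl | hn
    · rw [push_zero, push_zero]
    · rw [parent_eq_anc]
      rw [depth_parent] at hx
      exact push_anc a ((hidx n hn).trans hx) (Nat.sub_le _ _)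
  refine ⟨MPMap.ofVertices (fun x => push a (stage Ψ (depth x)) x)
    (spans_map_of_parent fun x => ?_) ?_ fun n => ⟨Ψ n, fun x hx => ?_⟩, fun n => ?_⟩
  · by_cases hx : x = S.root
    · simp [hx]
    · have h₁ := hpar _ x (apply_stage_le h₀ (depth (parent x)))
      have h₂ := stage_mono hΨ h₀ (m := depth (parent x)) (m' := depth x)
        (by rw [depth_parent]; omega)
      have h₃ := stage_succ_le hΨ h₀ (depth (parent x))
      rw [← depth_eq_depth_parent_add_one hx] at h₃
      rw [h₁]
      rcases h₂.eq_or_lt with h | h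
      · left
        rw [h]
      · right
        have h' : stage Ψ (depth x) = stage Ψ (depth (parent x)) + 1 := by omega
        have h₄ := apply_stage_le h₀ (depth x)
        rw [parent_eq_anc (push _ _ _), hd _ _ h₄, hanc _ _ (Nat.sub_le _ _) x h₄, h', Nat.add_sub_cancel]
  · have : stage Ψ (depth S.root) = 0 := by
      have := (hΨ.id_le _).trans (apply_stage_le h₀ (depth S.root))
      simpa using this
    rw [this, push_zero]
  · rw [hd _ _ (apply_stage_le h₀ _)]
    exact le_stage hΨ hx
  · refine ⟨Ψ n, fun x hx => ?_⟩
    have h := le_stage hΨ hx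
    have h' := apply_stage_le h₀ (depth x)
    rw [MPMap.ofVertices_vertex, level_vertex (by rw [hd _ _ h']; exact h), hanc _ _ h x h']

/-! ## The equivalence with inverse sequences -/

/-- A morphism of sequences describing the effect of a metrically proper map on deep vertices. -/
noncomputable def MPMap.seqHom {S T : RootedSimplicialTree.{u}} (f : MPMap S T) :
    TowerSet.SeqHom (levels S) (levels T) := f.exists_induces.choose

theorem MPMap.induces_seqHom {S T : RootedSimplicialTree.{u}} (f : MPMap S T) :
    f.Induces f.seqHom := f.exists_induces.choose_spec

/-- The functor sending a rooted tree to the inverse sequence of its levels. -/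
noncomputable def levelsFunctor : RootedSimplicialTree.{u} ⥤ TowerSet.{u} where
  obj := levels
  map := Quotient.map MPMap.seqHom fun f g h =>
    (f.induces_seqHom.of_homotopic h).equiv g.induces_seqHom
  map_id S := Quotient.sound ((MPMap.id S).induces_seqHom.equiv MPMap.induces_id)
  map_comp {R S T} φ ψ := by
    obtain ⟨f, rfl⟩ := Quotient.exists_rep φ
    obtain ⟨g, rfl⟩ := Quotient.exists_rep ψ
    exact Quotient.sound
      ((f.comp g).induces_seqHom.equiv (f.induces_seqHom.comp g.induces_seqHom))

theorem MPMap.Induces.levelsFunctor_map {S T : RootedSimplicialTree.{u}} {f : MPMap S T}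
    {a : TowerSet.SeqHom (levels S) (levels T)} (h : f.Induces a) :
    levelsFunctor.map f.homotopyClass = Quotient.mk _ a :=
  Quotient.sound (f.induces_seqHom.equiv h)

instance : (levelsFunctor.{u}).Faithful where
  map_injective {S T φ ψ} h := by
    obtain ⟨f, rfl⟩ := Quotient.exists_rep φ
    obtain ⟨g, rfl⟩ := Quotient.exists_rep ψ
    obtain ⟨a, ha⟩ := f.exists_induces
    obtain ⟨b, hb⟩ := g.exists_induces
    have h' : (Quotient.mk _ a : levels S ⟶ levels T) = Quotient.mk _ b :=
      ha.levelsFunctor_map.symm.trans (h.trans hb.levelsFunctor_map)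
    exact Quotient.sound (ha.homotopic (hb.of_equiv (Setoid.symm (Quotient.exact h'))))

instance : (levelsFunctor.{u}).Full where
  map_surjective {S T} ψ := by
    obtain ⟨a, rfl⟩ := Quotient.exists_rep ψ
    obtain ⟨f, hf⟩ := exists_mpMap_induces a
    exact ⟨f.homotopyClass, hf.levelsFunctor_map⟩

end RootedSimplicialTree

/-! ## The tree of an inverse sequence -/

namespace TowerSet

variable (X : TowerSet.{u})

/-- The vertices of the tree of an inverse sequence: a root and the elements of all the sets. -/
abbrev TreeVertex : Type u := Option (Σ n, X.obj n)

variable {X}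

/-- The parent of a vertex of the tree of an inverse sequence. -/
def treeParent : X.TreeVertex → X.TreeVertex
  | none => none
  | some ⟨0, _⟩ => none
  | some ⟨n + 1, x⟩ => some ⟨n, X.bond n.le_succ x⟩

/-- The depth of a vertex of the tree of an inverse sequence. -/
def treeDepth : X.TreeVertex → ℕ
  | none => 0
  | some ⟨n, _⟩ => n + 1

theorem treeDepth_eq {v : X.TreeVertex} (hv : v ≠ none) :
    treeDepth v = treeDepth (treeParent v) + 1 := by
  rcases v with _ | ⟨_ | n, x⟩
  · exact absurd rfl hv
  · rfl
  · rfl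

variable (X) in
/-- The graph of the tree of an inverse sequence. -/
def treeGraph : SimpleGraph X.TreeVertex where
  Adj v w := (v ≠ none ∧ treeParent v = w) ∨ (w ≠ none ∧ treeParent w = v)
  symm := ⟨fun _ _ h => h.symm⟩
  loopless := ⟨fun v h => by
    have key : ∀ v : X.TreeVertex, v ≠ none → treeParent v ≠ v := fun v hv e => by
      have := treeDepth_eq hv
      rw [e] at this
      omega
    rcases h with h | h <;> exact key v h.1 h.2⟩

theorem treeGraph_adj_parent {v : X.TreeVertex} (hv : v ≠ none) :
    X.treeGraph.Adj (treeParent v) v := Or.inr ⟨hv, rfl⟩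

theorem treeParent_eq_of_adj {v w : X.TreeVertex} (h : X.treeGraph.Adj v w)
    (h' : treeDepth w ≤ treeDepth v) : treeParent v = w := by
  rcases h with h | h
  · exact h.2
  · have := treeDepth_eq h.1
    rw [h.2] at this
    omega

theorem treeGraph_reachable (n : ℕ) (v : X.TreeVertex) (hv : treeDepth v = n) :
    X.treeGraph.Reachable none v := by
  induction n generalizing v with
  | zero =>
    by_cases h : v = none
    · rw [h]
    · have := treeDepth_eq h
      omega
  | succ n ih =>
    have h : v ≠ none := by
      rintro rfl
      exact absurd hv (Nat.succ_ne_zero n).symm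
    have := treeDepth_eq h
    exact (ih (treeParent v) (by omega)).trans (treeGraph_adj_parent h).reachable

/-- On a cycle, both neighbours of a vertex of maximal depth would be its parent, but the two
neighbours are distinct. -/
theorem treeGraph_isTree : X.treeGraph.IsTree := by
  classical
  refine ⟨⟨fun v w => (treeGraph_reachable _ v rfl).symm.trans (treeGraph_reachable _ w rfl)⟩, ?_⟩
  intro v c hc
  obtain ⟨w, hw, hmax⟩ := c.support.toFinset.exists_max_image treeDepth
    ⟨v, List.mem_toFinset.2 c.start_mem_support⟩
  rw [List.mem_toFinset] at hw
  have hc' := hc.rotate hw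
  have hle : ∀ z ∈ (c.rotate w hw).support, treeDepth z ≤ treeDepth w := fun z hz =>
    hmax z (List.mem_toFinset.2 ((c.mem_support_rotate_iff w hw).1 hz))
  have h₁ := treeParent_eq_of_adj ((c.rotate w hw).adj_snd hc'.not_nil)
    (hle _ (SimpleGraph.Walk.getVert_mem_support _ _))
  have h₂ := treeParent_eq_of_adj ((c.rotate w hw).adj_penultimate hc'.not_nil).symm
    (hle _ (SimpleGraph.Walk.getVert_mem_support _ _))
  exact hc'.snd_ne_penultimate (h₁.symm.trans h₂)

variable (X) in
/-- The tree of an inverse sequence: the elements of the `n`-th set are the vertices of depth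
`n + 1`, and edges join elements to their images under the bonding maps. -/
def tree : RootedSimplicialTree.{u} where
  V := X.TreeVertex
  graph := X.treeGraph
  isTree := treeGraph_isTree
  root := none

open RootedSimplicialTree

theorem depth_parent_tree (n : ℕ) (v : X.tree.V) (hv : treeDepth v = n) :
    depth v = n ∧ parent v = treeParent v := by
  induction n generalizing v with
  | zero =>
    by_cases h : v = none
    · subst h
      exact ⟨depth_root (T := X.tree), parent_root (T := X.tree)⟩
    · have := treeDepth_eq h
      omega
  | succ n ih =>
    have h : v ≠ none := by
      rintro rfl
      exact absurd hv (Nat.succ_ne_zero n).symm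
    have h₁ := treeDepth_eq h
    have hadj : X.tree.graph.Adj (treeParent v) v := treeGraph_adj_parent h
    obtain ⟨h₂, h₃⟩ := ih (treeParent v) (by omega)
    -- If `treeParent v` were deeper than v in the graph, then v would be its parent, hence by
    -- induction its `treeParent`, although `treeDepth` drops along `treeParent`.
    rcases depth_of_adj hadj with h₄ | h₄
    · exfalso
      have h₅ := eq_parent_of_adj hadj.symm h₄
      rw [h₃] at h₅
      have hne : treeParent v ≠ none := by
        intro e
        have h₆ : depth (T := X.tree) (treeParent v) = 0 :=
          (congrArg (depth (T := X.tree)) e).trans depth_root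
        omega
      have h₆ := treeDepth_eq hne
      rw [← h₅] at h₆
      omega
    · exact ⟨by omega, (eq_parent_of_adj hadj h₄).symm⟩

theorem depth_tree (v : X.tree.V) : depth v = treeDepth v := (depth_parent_tree _ v rfl).1

theorem parent_tree (v : X.tree.V) : parent v = treeParent v := (depth_parent_tree _ v rfl).2

variable (X) in
/-- An element of an inverse sequence as a vertex of the tree. -/
def treeVertex {n : ℕ} (x : X.obj n) : X.tree.V := some ⟨n, x⟩

theorem depth_treeVertex {n : ℕ} (x : X.obj n) : depth (X.treeVertex x) = n + 1 := depth_tree _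

theorem parent_treeVertex_succ {n : ℕ} (x : X.obj (n + 1)) :
    parent (X.treeVertex x) = X.treeVertex (X.bond n.le_succ x) := parent_tree _

theorem anc_treeVertex {n m : ℕ} (h : n ≤ m) (x : X.obj m) :
    anc (X.treeVertex x) (n + 1) = X.treeVertex (X.bond h x) := by
  induction m, h using Nat.le_induction with
  | base =>
    rw [bond_refl, anc_of_depth_le (depth_treeVertex x).le]
  | succ m h ih =>
    rw [← anc_parent _ (by rw [parent_treeVertex_succ, depth_treeVertex]; omega),
      parent_treeVertex_succ, ih, bond_bond]

theorem exists_treeVertex_eq {n : ℕ} {v : X.tree.V} (h : depth v = n + 1) :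
    ∃ x : X.obj n, X.treeVertex x = v := by
  rw [depth_tree] at h
  rcases v with _ | ⟨m, x⟩
  · exact absurd h (Nat.succ_ne_zero n).symm
  · obtain rfl : m = n := Nat.succ_injective h
    exact ⟨x, rfl⟩

theorem treeVertex_injective {n : ℕ} :
    Function.Injective (X.treeVertex : X.obj n → X.tree.V) := by
  intro x y h
  exact eq_of_heq (Sigma.mk.inj (Option.some.inj h)).2

/-! ## Isomorphisms of inverse sequences -/

variable (X) in
/-- The inclusion of an inverse sequence into the levels of its tree. -/
noncomputable def toLevels : SeqHom X (levels X.tree) where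
  idx n := n
  -- Elements of the n-th set sit at depth n + 1 because of the added root, so one step down is
  -- needed to reach level n.
  map n x := ⟨anc (X.treeVertex x) n, depth_anc_of_le (by rw [depth_treeVertex]; omega)⟩
  coherent {n n'} h := ⟨n', h, le_rfl, fun x => Subtype.ext (by
    change anc (X.treeVertex (X.bond h x)) n = anc (anc (X.treeVertex (X.bond _ x)) n') n
    rw [← anc_treeVertex h, bond_refl, anc_anc _ h, anc_anc _ (by omega)])⟩

/-- The element of an inverse sequence given by a vertex of its tree. -/
noncomputable def ofTreeVertex {n : ℕ} (v : X.tree.V) (h : depth v = n + 1) : X.obj n :=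
  (exists_treeVertex_eq h).choose

theorem treeVertex_ofTreeVertex {n : ℕ} (v : X.tree.V) (h : depth v = n + 1) :
    X.treeVertex (ofTreeVertex v h) = v := (exists_treeVertex_eq h).choose_spec

variable (X) in
/-- The shift from the levels of the tree of an inverse sequence to the sequence. -/
noncomputable def ofLevels : SeqHom (levels X.tree) X where
  idx n := n + 1
  map n v := ofTreeVertex v.1 v.2
  coherent {n n'} h := ⟨n' + 1, by omega, le_rfl, fun v => treeVertex_injective (by
    rw [← anc_treeVertex h, treeVertex_ofTreeVertex, treeVertex_ofTreeVertex, bond_refl]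
    rfl)⟩

theorem treeVertex_ofLevels {n : ℕ} (v : (levels X.tree).obj (n + 1)) :
    X.treeVertex (X.ofLevels.map n v) = v.1 :=
  treeVertex_ofTreeVertex v.1 v.2

variable (X) in
/-- An inverse sequence is isomorphic to the levels of its tree. -/
noncomputable def isoLevels : X ≅ levels X.tree where
  hom := Quotient.mk _ X.toLevels
  inv := Quotient.mk _ X.ofLevels
  -- Both composites are bonding maps from index n + 1 to n, hence equivalent to identities.
  hom_inv_id := Quotient.sound fun n => ⟨n + 1, le_rfl, n.le_succ, fun x =>
    treeVertex_injective ((treeVertex_ofLevels _).trans ((anc_treeVertex n.le_succ _).trans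
      (congrArg (fun y => X.treeVertex (X.bond n.le_succ y)) (X.bond_refl (n + 1) x))))⟩
  inv_hom_id := Quotient.sound fun n => ⟨n + 1, le_rfl, n.le_succ, fun v => Subtype.ext
    (congrArg (fun w => anc w n) ((treeVertex_ofLevels _).trans (anc_of_depth_le v.2.le)))⟩

/-! ### Passing to cofinal subsequences -/

variable (X) in
/-- A subsequence of an inverse sequence. -/
def subsequence (Ψ : ℕ → ℕ) (hΨ : Monotone Ψ) : TowerSet.{u} where
  obj n := X.obj (Ψ n)
  bond h := X.bond (hΨ h)
  bond_refl n := X.bond_refl (Ψ n)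
  bond_bond h h' := X.bond_bond (hΨ h) (hΨ h')

variable (X) in
/-- The morphism from an inverse sequence to a subsequence given by the identities. -/
def toSubsequence (Ψ : ℕ → ℕ) (hΨ : Monotone Ψ) : SeqHom X (X.subsequence Ψ hΨ) where
  idx := Ψ
  map _ x := x
  coherent {n n'} h := ⟨Ψ n', hΨ h, le_rfl, fun x => by
    rw [bond_refl]
    rfl⟩

variable (X) in
/-- The morphism from a subsequence of an inverse sequence given by the bonding maps. -/
def ofSubsequence (Ψ : ℕ → ℕ) (hΨ : Monotone Ψ) (hle : ∀ n, n ≤ Ψ n) :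
    SeqHom (X.subsequence Ψ hΨ) X where
  idx n := n
  map n x := X.bond (hle n) x
  coherent {n n'} h := ⟨n', h, le_rfl, fun x => by
    exact (X.bond_bond (hle n) (hΨ h) x).trans
      ((congrArg (fun y => X.bond h (X.bond (hle n') y)) (X.bond_refl _ x)).trans
        (X.bond_bond h (hle n') x)).symm⟩

variable (X) in
/-- An inverse sequence is isomorphic to its cofinal subsequences. -/
def isoSubsequence (Ψ : ℕ → ℕ) (hΨ : Monotone Ψ) (hle : ∀ n, n ≤ Ψ n) :
    X ≅ X.subsequence Ψ hΨ where
  hom := Quotient.mk _ (X.toSubsequence Ψ hΨ)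
  inv := Quotient.mk _ (X.ofSubsequence Ψ hΨ hle)
  hom_inv_id := Quotient.sound fun n => ⟨Ψ n, le_rfl, hle n, fun x =>
    congrArg (X.bond (hle n)) (X.bond_refl (Ψ n) x)⟩
  inv_hom_id := Quotient.sound fun n => ⟨Ψ n, le_rfl, hle n, fun x =>
    X.bond_bond (hle _) (hΨ le_rfl) x⟩

end TowerSet

/-! ### Essential surjectivity and simplicial representatives of morphisms -/

namespace RootedSimplicialTree

open TowerSet

instance : (levelsFunctor.{u}).EssSurj where
  mem_essImage X := ⟨X.tree, ⟨X.isoLevels.symm⟩⟩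

instance : (levelsFunctor.{u}).IsEquivalence where

/-- A map of vertices commuting with parents induces a level preserving morphism of sequences. -/
theorem exists_simplicial_induces {S T : RootedSimplicialTree.{u}} (φ : S.V → T.V)
    (hd : ∀ x, depth (φ x) = depth x) (hp : ∀ x, φ (parent x) = parent (φ x)) :
    ∃ (f : MPMap S T) (c : SeqHom (levels S) (levels T)), f.IsSimplicial ∧ f.PreservesRootDist ∧
      f.Induces c ∧ (∀ n, c.idx n = n) ∧
        ∀ n (x : S.V), n ≤ depth x → push c n x = anc (φ x) n := by
  have hanc : ∀ x n, φ (anc x n) = anc (φ x) n := by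
    intro x n
    rw [anc, anc, hd]
    exact (Function.Semiconj.iterate_right (f := φ) (ga := parent) (gb := parent) hp _) x
  let f : MPMap S T := MPMap.ofVertices φ (spans_map_of_parent fun x => Or.inr (hp x))
    (by rw [← depth_eq_zero, hd, depth_root]) (fun n => ⟨n, fun x hx => by rwa [hd]⟩)
  let c : SeqHom (levels S) (levels T) :=
    { idx := fun n => n
      map := fun n x => ⟨φ x.1, (hd _).trans x.2⟩
      coherent := fun {n n'} h => ⟨n', h, le_rfl, fun x => Subtype.ext (by
        rw [bond_refl]
        exact hanc x.1 n)⟩ }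
  have hc : ∀ n (x : S.V), n ≤ depth x → push c n x = anc (φ x) n := fun n x hx => by
    rw [push_of_le c hx]
    exact hanc x n
  refine ⟨f, c, MPMap.isSimplicial_ofVertices, MPMap.preservesRootDist_ofVertices hd,
    fun n => ⟨n, fun x hx => ?_⟩, fun _ => rfl, hc⟩
  rw [hc n x hx, MPMap.ofVertices_vertex, Realization.level_vertex (by rwa [hd])]

/-- Every morphism of rooted trees becomes a simplicial map preserving the distance to the root
after replacing the source by an isomorphic tree. -/
theorem exists_iso_simplicial {S T : RootedSimplicialTree.{u}} (φ : S ⟶ T) :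
    ∃ (R : RootedSimplicialTree.{u}) (i : S ≅ R) (f : MPMap R T), f.IsSimplicial ∧
      f.PreservesRootDist ∧ φ = i.hom ≫ f.homotopyClass := by
  obtain ⟨a, ha⟩ := Quotient.exists_rep (levelsFunctor.map φ)
  obtain ⟨Ψ, hΨ, h₀, hidx, hanc⟩ := exists_strictMono_push a
  have hmono : Monotone fun n => Ψ (n + 1) := fun m n h => hΨ.monotone (by omega)
  -- The index is shifted because the n-th set becomes depth n + 1 of the tree. Its elements are
  -- vertices of S of depth Ψ (n + 1), where a has a coherent value at level n + 1.
  let X : TowerSet.{u} := (levels S).subsequence (fun n => Ψ (n + 1)) hmono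
  let e : levels S ≅ X := (levels S).isoSubsequence _ hmono
    fun n => n.le_succ.trans (hΨ.id_le (n + 1))
  let i : S ≅ X.tree := levelsFunctor.preimageIso (e ≪≫ X.isoLevels)
  let ψ : X.tree.V → T.V := fun v => match v with
    | none => T.root
    | some ⟨n, x⟩ => push a (n + 1) x.1
  have hd : ∀ v, depth (ψ v) = depth v := by
    rintro (_ | ⟨n, x⟩)
    · exact depth_root.trans (depth_root (T := X.tree)).symm
    · exact (depth_push a ((hidx _ (by omega)).trans x.2.ge)).trans (depth_treeVertex x).symm
  have hx : ∀ n (x : X.obj n), depth (push a (n + 1) x.1) = n + 1 := fun n x =>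
    depth_push a ((hidx _ (by omega)).trans x.2.ge)
  have hp : ∀ v, ψ (parent v) = parent (ψ v) := by
    rintro (_ | ⟨_ | n, x⟩)
    · exact (congrArg ψ (parent_root (T := X.tree))).trans parent_root.symm
    · refine (congrArg ψ (parent_tree (X := X) _)).trans (depth_eq_zero.1 ?_).symm
      rw [depth_parent]
      exact Nat.sub_eq_zero_of_le (hx 0 x).le
    · refine (congrArg ψ (parent_tree (X := X) _)).trans ?_
      change push a (n + 1) (anc x.1 (Ψ (n + 1))) = parent (push a (n + 2) x.1)
      have hx' : depth x.1 = Ψ (n + 2) := x.2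
      rw [push_anc a (hidx _ (by omega)) (by rw [hx']; exact hΨ.monotone (by omega)),
        parent_eq_anc, hx (n + 1) x]
      -- Coherence of a at depth Ψ (n + 2) is exactly compatibility with parents.
      exact (hanc (n + 1) (n + 2) (by omega) x.1 hx'.ge).symm
  obtain ⟨f, c, hf, hf', hfc, hcidx, hc⟩ := exists_simplicial_induces ψ hd hp
  refine ⟨X.tree, i, f, hf, hf', levelsFunctor.map_injective ?_⟩
  rw [Functor.map_comp, Functor.preimageIso_hom, Functor.map_preimage, hfc.levelsFunctor_map,
    ← ha]
  -- This represents the image of i under `levelsFunctor`; faithfulness reduces the claim to an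
  -- equivalence of morphisms of sequences.
  let b : SeqHom (levels S) (levels X.tree) := ((levels S).toSubsequence _ hmono).comp X.toLevels
  change (Quotient.mk _ a : levels S ⟶ levels T) = Quotient.mk _ (b.comp c)
  refine Quotient.sound (equiv_iff_push.2 fun n => ⟨Ψ (n + 1), fun x hx' => ?_⟩)
  let y : X.obj n := ⟨anc x (Ψ (n + 1)), depth_anc_of_le hx'⟩
  have hy : push b n x = anc (X.treeVertex y) n := push_of_le b hx'
  have hny : n ≤ depth (X.treeVertex y) := by rw [depth_treeVertex]; omega
  rw [push_comp c b (by rw [hcidx]; exact hx'), hcidx, hy, push_anc c (hcidx n).le hny, hc n _ hny]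
  change _ = anc (push a (n + 1) (anc x (Ψ (n + 1)))) n
  rw [push_anc a (hidx _ (by omega)) hx', hanc _ _ n.le_succ x hx']

/-- Only the source has to be replaced; the target is kept, with j the identity. -/
theorem simplicialClasses_eq_top : simplicialClasses.{u} = ⊤ := by
  refine top_le_iff.1 fun a b φ _ => ?_
  obtain ⟨R, i, f, hf, hf', h⟩ := exists_iso_simplicial ((fromSkeleton _).map φ)
  exact ⟨R, _, i, Iso.refl _, f, hf, hf', by simpa using h⟩

end RootedSimplicialTree

open RootedSimplicialTree

/-- The classes of simplicial maps preserving the distance to the root are the morphisms of a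
category whose objects are the isomorphism classes of rooted simplicial trees, and **Tower-Set***
is equivalent to this category. -/
theorem proposition8p4 :
    ∃ _ : (simplicialClasses.{u}).IsMultiplicative,
      Nonempty (TowerSetStar.{u} ≌ WideSubcategory simplicialClasses.{u}) := by
  have hall : ∀ {a b : TreeStar.{u}} (φ : a ⟶ b), simplicialClasses φ := fun φ => by
    rw [simplicialClasses_eq_top]
    trivial
  let hmul : (simplicialClasses.{u}).IsMultiplicative :=
    { id_mem := fun _ => hall _
      comp_mem := fun _ _ _ _ => hall _ }
  refine ⟨hmul, ⟨?_⟩⟩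
  have hfull : (wideSubcategoryInclusion simplicialClasses.{u}).Full :=
    ⟨fun φ => ⟨⟨φ, hall φ⟩, rfl⟩⟩
  have hess : (wideSubcategoryInclusion simplicialClasses.{u}).EssSurj :=
    ⟨fun a => ⟨⟨a⟩, ⟨Iso.refl a⟩⟩⟩
  have : (wideSubcategoryInclusion simplicialClasses.{u}).IsEquivalence := {}
  exact (skeletonEquivalence TowerSet.{u}).trans <|
    levelsFunctor.{u}.asEquivalence.symm.trans <|
      (skeletonEquivalence RootedSimplicialTree.{u}).symm.trans
        (wideSubcategoryInclusion simplicialClasses.{u}).asEquivalence.symm
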